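/- Let $(\mathbb B,\|\cdot\|)$ be a separable real Banach space that is $r$-smooth for some $r\in(1,2]$, i.e. there is an equivalent norm $\|\cdot\|'$ on $\mathbb B$ with $$\sup_{t>0}\ \sup_{\|x\|'=\|y\|'=1}\frac{\|x+ty\|'+\|x-ty\|'-2}{t^r}<\infty .$$ Let $m\ge 1$ be an integer and $p\in(1,r]$. For $n\ge m$ put $\operatorname{Inc}_n^m=\{\mathbf i=(i_1,\dots,i_m)\in\mathbb N^m: 1\le i_1<\dots<i_m\le n\}$. For every real $q\ge p$ there is a finite constant $K=K(m,p,q,\mathbb B)$, depending only on $m,p,q$ and $\mathbb B$, such that the following holds. Let $(\xi_i)_{i\ge1}$ be an i.i.d. sequence with values in a measurable space $(S,\mathcal S)$, write $\xi_J=(\xi_j)_{j\in J}$ and $\xi_{\mathbf i}=(\xi_{i_1},\dots,\xi_{i_m})$, and for every $\mathbf i=(i_1,\dots,i_m)$ with $1\le i_1<\dots<i_m$ let $h_{\mathbf i}\colon S^m\to\mathbb B$ be measurable, with $h_{\mathbf i}(\xi_1,\dots,\xi_m)$ integrable, and degenerated: for each $\ell_0\in\{1,\dots,m\}$, $$\mathbb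 E\big[h_{\mathbf i}(\xi_1,\dots,\xi_m)\mid \xi_{\{1,\dots,m\}\setminus\{\ell_0\}}\big]=0\quad\text{almost surely.}$$ Let $U_n=\sum_{\mathbf i\in\operatorname{Inc}_n^m}h_{\mathbf i}(\xi_{\mathbf i})$. Then for every $N\ge m$, as an inequality in $[0,\infty]$, $$\begin{aligned}\mathbb E\max_{m\le n\le N}\|U_n\|^q\le{}& K\sum_{\mathbf i\in\operatorname{Inc}_N^m}\mathbb E\|h_{\mathbf i}(\xi_1,\dots,\xi_m)\|^q\\ &+K\sum_{\emptyset\subsetneq J\subsetneq\{1,\dots,m\}}\ \sum_{a\in\mathbb N^J}\mathbb E\Bigg[\bigg(\sum_{\mathbf i\in\operatorname{Inc}_N^m:\ i_j=a_j\ \forall j\in J}\mathbb E\big[\|h_{\mathbf i}(\xi_1,\dots,\xi_m)\|^p\mid\xi_J\big]\bigg)^{q/p}\Bigg]\\ &+K\bigg(\sum_{\mathbf i\in\operatorname{Inc}_N^m}\mathbb E\|h_{\mathbf i}(\xi_1,\dots,\xi_m)\|^p\bigg)^{q/p}.\end{aligned}$$ In particular, for $q=p$, there is a finite constant $K(m,p,\mathbb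 B)$, depending only on $m,p$ and $\mathbb B$, such that in the same setting $$\mathbb E\max_{m\le n\le N}\|U_n\|^p\le K(m,p,\mathbb B)\sum_{\mathbf i\in\operatorname{Inc}_N^m}\mathbb E\|h_{\mathbf i}(\xi_1,\dots,\xi_m)\|^p .$$ -/

import Mathlib

open MeasureTheory ProbabilityTheory
open scoped ENNReal NNReal

universe u v w

/-- `r`-smoothness of a real Banach space: some equivalent norm `nu` satisfies
`sup_{t > 0} sup_{nu x = nu y = 1} (nu (x + t y) + nu (x - t y) - 2) / t ^ r < ∞`. -/
def IsRSmooth (B : Type w) [NormedAddCommGroup B] [NormedSpace ℝ B] (r : ℝ) : Prop :=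
  ∃ nu : Seminorm ℝ B,
    (∃ a b : ℝ, 0 < a ∧ 0 < b ∧ ∀ x : B, a * ‖x‖ ≤ nu x ∧ nu x ≤ b * ‖x‖) ∧
    ∃ C : ℝ, ∀ t : ℝ, 0 < t → ∀ x y : B, nu x = 1 → nu y = 1 →
      (nu (x + t • y) + nu (x - t • y) - 2) / t ^ r ≤ C

/-- The strictly increasing `m`-tuples of indices among the first `n` indices. Indices start
at `0`, so that these are the tuples `0 ≤ i 0 < ⋯ < i (m - 1) ≤ n - 1`. -/
noncomputable def Inc (m n : ℕ) : Finset (Fin m → ℕ) :=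
  open Classical in (Fintype.piFinset fun _ : Fin m => Finset.range n).filter StrictMono

section

variable {Ω : Type u} [MeasurableSpace Ω] {S : Type v} [MeasurableSpace S]

/-- `ξ` is an i.i.d. sequence of random variables with values in the measurable space `S`. -/
structure IsIIDSeq (ξ : ℕ → Ω → S) (P : Measure Ω) : Prop where
  measurable : ∀ i, Measurable (ξ i)
  indep : iIndepFun ξ P
  identDistrib : ∀ i, IdentDistrib (ξ i) (ξ 0) P P

/-- The vector of the first `m` variables of the sequence. -/
def firstVars (ξ : ℕ → Ω → S) (m : ℕ) (ω : Ω) : Fin m → S := fun l => ξ l ω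

/-- The σ-algebra generated by the variables `ξ j`, `j ∈ J`, where `J` is a set of positions
among the first `m` ones. -/
abbrev sigmaOf (ξ : ℕ → Ω → S) {m : ℕ} (J : Finset (Fin m)) : MeasurableSpace Ω :=
  MeasurableSpace.comap (fun (ω : Ω) (j : J) => ξ (j : Fin m) ω) MeasurableSpace.pi

variable {B : Type w} [NormedAddCommGroup B] [NormedSpace ℝ B]

/-- The kernel `h` is degenerated with respect to `ξ`: `h (ξ_1, …, ξ_m)` is integrable, and its
conditional expectation given all but any one of the variables `ξ_1, …, ξ_m` vanishes. -/
structure IsDegenerated [CompleteSpace B] {m : ℕ} (h : (Fin m → S) → B) (ξ : ℕ → Ω → S)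
    (P : Measure Ω) : Prop where
  integrable : Integrable (fun ω => h (firstVars ξ m ω)) P
  condExp_eq_zero : ∀ l : Fin m,
    P[fun ω => h (firstVars ξ m ω) | sigmaOf ξ ({l}ᶜ : Finset (Fin m))] =ᵐ[P] 0

/-- The `U`-statistic `U_n = ∑_{i ∈ Inc_n^m} h_i (ξ_{i_1}, …, ξ_{i_m})`. -/
noncomputable def UStat {m : ℕ} (h : (Fin m → ℕ) → (Fin m → S) → B) (ξ : ℕ → Ω → S) (n : ℕ)
    (ω : Ω) : B :=
  ∑ i ∈ Inc m n, h i fun l => ξ (i l) ω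

/-- `E [max_{m ≤ n ≤ N} ‖U_n‖ ^ q]`, with values in `[0, ∞]`. -/
noncomputable def maxMoment {m : ℕ} (h : (Fin m → ℕ) → (Fin m → S) → B) (ξ : ℕ → Ω → S)
    (P : Measure Ω) (N : ℕ) (q : ℝ) : ℝ≥0∞ :=
  ∫⁻ ω, (Finset.Icc m N).sup (fun n => ‖UStat h ξ n ω‖ₑ ^ q) ∂P

/-- `∑_{i ∈ Inc_N^m} E [‖h_i (ξ_1, …, ξ_m)‖ ^ q]`, with values in `[0, ∞]`. -/
noncomputable def sumMoments {m : ℕ} (h : (Fin m → ℕ) → (Fin m → S) → B) (ξ : ℕ → Ω → S)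
    (P : Measure Ω) (N : ℕ) (q : ℝ) : ℝ≥0∞ :=
  ∑ i ∈ Inc m N, ∫⁻ ω, ‖h i (firstVars ξ m ω)‖ₑ ^ q ∂P

/-- For a set `J` of positions and values `a` of the indices at these positions, the random
variable `∑ E [‖h_i (ξ_1, …, ξ_m)‖ ^ p | ξ_J]`, where the sum runs over the `i ∈ Inc_N^m` that
agree with `a` on `J`. The conditional expectation is that of a `[0, ∞]`-valued variable. -/
noncomputable def condMomentSum {m : ℕ} (h : (Fin m → ℕ) → (Fin m → S) → B) (ξ : ℕ → Ω → S)
    (P : Measure Ω) (N : ℕ) (p : ℝ) (J : Finset (Fin m)) (a : J → ℕ) (ω : Ω) : ℝ≥0∞ :=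
  open Classical in
  ∑ i ∈ (Inc m N).filter (fun i => ∀ j : J, i j = a j),
    condLExp (sigmaOf ξ J) P (fun ω' => ‖h i (firstVars ξ m ω')‖ₑ ^ p) ω

end

/-!
For `p ≤ r`, an `r`-smooth norm satisfies `‖x + y‖ ^ p + ‖x - y‖ ^ p ≤ 2 ‖x‖ ^ p + C ‖y‖ ^ p`. This
inequality integrates: it passes to the spaces `L^p(ν; 𝔹)` with the same constant, and it improves
itself to the powers `p σ` of their norms, `σ = q / p ≥ 1`. Applied to the increments of a
martingale, and combined with Doob's maximal inequality, it yields by absorption a Rosenthal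
inequality for martingales with values in `L^p(ν; 𝔹)`, with constants not depending on `ν`.

After a modification on null sets the kernels are centered in each argument at every point, and
all conditional expectations are partial integrals. Then `n ↦ ‖U_n‖` is a submartingale, so Doob's
inequality removes the maximum. The sum `U_N` is a martingale in its largest index, whose
increments are sums over the remaining indices. Rosenthal's inequality bounds it by the moments of
the increments and by a predictable term, in which the last index and the last variable have become
an additional coordinate of `ν`. Repeating this for each of the `m` indices leaves one mixed moment
for every set `J` of positions, namely of those indices where the first alternative was taken.
-/

section ScalarInequalities

theorem rpow_add_mul_sub_le_rpow {x y β : ℝ} (hx : 0 ≤ x) (hy : 0 ≤ y) (hβ : 1 ≤ β) :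
    y ^ β + β * y ^ (β - 1) * (x - y) ≤ x ^ β := by
  rcases hy.eq_or_lt with rfl | hy
  · rcases hβ.eq_or_lt with rfl | hβ
    · simp
    · simpa [Real.zero_rpow (zero_lt_one.trans hβ).ne', Real.zero_rpow (sub_pos.2 hβ).ne']
        using Real.rpow_nonneg hx β
  have bernoulli : 1 + β * (x / y - 1) ≤ (1 + (x / y - 1)) ^ β :=
    one_add_mul_self_le_rpow_one_add (by linarith [div_nonneg hx hy.le]) hβ
  rw [add_sub_cancel, Real.div_rpow hx hy.le, le_div_iff₀ (by positivity)] at bernoulli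
  calc y ^ β + β * y ^ (β - 1) * (x - y) = (1 + β * (x / y - 1)) * y ^ β := by
        rw [Real.rpow_sub_one hy.ne']
        field_simp
    _ ≤ x ^ β := bernoulli

theorem exists_abs_rpow_sub_one_le (γ L : ℝ) (hγ : 0 ≤ γ) :
    ∃ c, 0 ≤ c ∧ ∀ y, 0 ≤ y → y ≤ L → |y ^ γ - 1| ≤ c * |y - 1| := by
  refine ⟨1 + γ + γ * |L| ^ (γ - 1), by positivity, fun y hy hyL => ?_⟩
  have hLγ : 0 ≤ γ * |L| ^ (γ - 1) := by positivity
  rcases le_total y 1 with hy1 | hy1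
  · have lower : (1 + γ) * (y - 1) ≤ y ^ γ - 1 := by
      rcases le_total γ 1 with hγ1 | hγ1
      · have := Real.rpow_le_rpow_of_exponent_ge' hy hy1 hγ hγ1
        rw [Real.rpow_one] at this
        nlinarith
      · have := rpow_add_mul_sub_le_rpow hy zero_le_one hγ1
        simp only [Real.one_rpow] at this
        nlinarith
    rw [abs_of_nonpos (sub_nonpos.2 (Real.rpow_le_one hy hy1 hγ)), abs_of_nonpos (sub_nonpos.2 hy1)]
    nlinarith
  · have upper : y ^ γ - 1 ≤ (1 + γ * |L| ^ (γ - 1)) * (y - 1) := by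
      rcases le_total γ 1 with hγ1 | hγ1
      · have := Real.rpow_le_rpow_of_exponent_le hy1 hγ1
        rw [Real.rpow_one] at this
        nlinarith
      · have tangent := rpow_add_mul_sub_le_rpow zero_le_one hy hγ1
        have slope : γ * y ^ (γ - 1) * (y - 1) ≤ γ * |L| ^ (γ - 1) * (y - 1) := by
          have := sub_nonneg.2 hγ1
          have := sub_nonneg.2 hy1
          gcongr
          exact hyL.trans (le_abs_self L)
        rw [Real.one_rpow] at tangent
        linarith
    rw [abs_of_nonneg (sub_nonneg.2 (Real.one_le_rpow hy1 hγ)), abs_of_nonneg (sub_nonneg.2 hy1)]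
    nlinarith

theorem exists_rpow_le_one_add_mul_add_sq (β L : ℝ) (hβ : 1 ≤ β) :
    ∃ c, 0 ≤ c ∧ ∀ y, 0 ≤ y → y ≤ L → y ^ β ≤ 1 + β * (y - 1) + c * (y - 1) ^ 2 := by
  obtain ⟨c, hc, lipschitz⟩ := exists_abs_rpow_sub_one_le (β - 1) L (sub_nonneg.2 hβ)
  refine ⟨β * c, by positivity, fun y hy hyL => ?_⟩
  have tangent := rpow_add_mul_sub_le_rpow zero_le_one hy hβ
  have slope : (y ^ (β - 1) - 1) * (y - 1) ≤ c * (y - 1) ^ 2 := by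
    calc (y ^ (β - 1) - 1) * (y - 1) ≤ |y ^ (β - 1) - 1| * |y - 1| := by
          rw [← abs_mul]
          exact le_abs_self _
      _ ≤ c * |y - 1| * |y - 1| := by gcongr; exact lipschitz y hy hyL
      _ = c * (y - 1) ^ 2 := by rw [mul_assoc, ← pow_two, sq_abs]
  have := mul_le_mul_of_nonneg_left slope (zero_le_one.trans hβ)
  rw [Real.one_rpow] at tangent
  linarith

theorem exists_rpow_mul_le_one_add (α β p : ℝ) (hα : 0 ≤ α) (hβ : 1 ≤ β) (hp : p ≤ 2) :
    ∃ c, 0 ≤ c ∧ ∀ y s : ℝ, 0 ≤ y → 0 < s → s ≤ 1 → |y - 1| ≤ s →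
      y ^ (α * β) ≤ 1 + β * (y ^ α - 1) + c * s ^ p := by
  obtain ⟨c₁, hc₁, lipschitz⟩ := exists_abs_rpow_sub_one_le α 2 hα
  obtain ⟨c₂, hc₂, taylor⟩ := exists_rpow_le_one_add_mul_add_sq β (2 ^ α) hβ
  refine ⟨c₂ * c₁ ^ 2, by positivity, fun y s hy hs hs1 hys => ?_⟩
  have hy2 : y ≤ 2 := by linarith [(abs_le.1 hys).2]
  have square : (y ^ α - 1) ^ 2 ≤ c₁ ^ 2 * s ^ p := by
    calc (y ^ α - 1) ^ 2 = |y ^ α - 1| ^ 2 := (sq_abs _).symm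
      _ ≤ (c₁ * s) ^ 2 := by
        gcongr
        exact (lipschitz y hy hy2).trans (by gcongr)
      _ = c₁ ^ 2 * s ^ (2 : ℝ) := by rw [mul_pow, Real.rpow_two]
      _ ≤ c₁ ^ 2 * s ^ p := by
        gcongr ?_ * ?_
        exact Real.rpow_le_rpow_of_exponent_ge hs hs1 hp
  calc y ^ (α * β) = (y ^ α) ^ β := Real.rpow_mul hy α β
    _ ≤ 1 + β * (y ^ α - 1) + c₂ * (y ^ α - 1) ^ 2 :=
      taylor _ (by positivity) (by gcongr)
    _ ≤ 1 + β * (y ^ α - 1) + c₂ * c₁ ^ 2 * s ^ p := by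
      rw [mul_assoc]
      gcongr

theorem exists_normalized_two_point_rpow (α β p C : ℝ) (hα : 0 ≤ α) (hβ : 1 ≤ β) (hp : p ≤ 2)
    (hC : 0 ≤ C) :
    ∃ C', 0 ≤ C' ∧ ∀ s u v, 0 < s → s ≤ 1 → 0 ≤ u → 0 ≤ v → |u - 1| ≤ s → |v - 1| ≤ s →
      u ^ α + v ^ α ≤ 2 + C * s ^ p → u ^ (α * β) + v ^ (α * β) ≤ 2 + C' * s ^ p := by
  obtain ⟨c, hc, h⟩ := exists_rpow_mul_le_one_add α β p hα hβ hp
  refine ⟨β * C + 2 * c, by positivity, fun s u v hs hs1 hu hv hus hvs huv => ?_⟩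
  have hu := h u s hu hs hs1 hus
  have hv := h v s hv hs hs1 hvs
  nlinarith

theorem rpow_add_rpow_le_of_le_two_mul {b u v γ : ℝ} (hγ : 0 ≤ γ) (hu : 0 ≤ u) (hv : 0 ≤ v)
    (hub : u ≤ 2 * b) (hvb : v ≤ 2 * b) : u ^ γ + v ^ γ ≤ 2 * 2 ^ γ * b ^ γ := by
  have hb : 0 ≤ b := by linarith
  rw [mul_assoc, ← Real.mul_rpow zero_le_two hb, two_mul (_ ^ γ)]
  gcongr

theorem rpow_eq_rpow_mul_div_rpow {a x : ℝ} (ha : 0 < a) (hx : 0 ≤ x) (γ : ℝ) :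
    x ^ γ = a ^ γ * (x / a) ^ γ := by
  rw [Real.div_rpow hx ha.le, mul_div_cancel₀ _ (by positivity)]

/-- The smoothness inequality at scale `b ≤ a`, for `α`-th powers, self-improves to `α * β`-th
powers and to all scales. -/
theorem exists_two_point_rpow (α β p C : ℝ) (hα : 0 ≤ α) (hβ : 1 ≤ β) (hp : p ≤ 2)
    (hC : 0 ≤ C) :
    ∃ C', 0 ≤ C' ∧ ∀ a b u v, 0 ≤ a → 0 ≤ b → 0 ≤ u → 0 ≤ v → |u - a| ≤ b → |v - a| ≤ b →
      (0 < b → b ≤ a → u ^ α + v ^ α ≤ a ^ α * (2 + C * (b / a) ^ p)) →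
      u ^ (α * β) + v ^ (α * β) ≤
        2 * a ^ (α * β) + C' * (a ^ (α * β - p) * b ^ p + b ^ (α * β)) := by
  obtain ⟨C', hC', normalized⟩ := exists_normalized_two_point_rpow α β p C hα hβ hp hC
  refine ⟨C' + 2 * 2 ^ (α * β), by positivity, fun a b u v ha hb hu hv hua hva huv => ?_⟩
  have hub := abs_le.1 hua
  have hvb := abs_le.1 hva
  rcases hb.eq_or_lt with rfl | hb
  · rw [show u = a by linarith, show v = a by linarith, ← two_mul]
    exact le_add_of_nonneg_right (by positivity)
  rcases lt_or_ge a b with hab | hba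
  · calc u ^ (α * β) + v ^ (α * β) ≤ 2 * 2 ^ (α * β) * b ^ (α * β) :=
          rpow_add_rpow_le_of_le_two_mul (by positivity) hu hv (by linarith) (by linarith)
      _ ≤ (C' + 2 * 2 ^ (α * β)) * (a ^ (α * β - p) * b ^ p + b ^ (α * β)) := by
          gcongr
          · linarith
          · exact le_add_of_nonneg_left (by positivity)
      _ ≤ _ := le_add_of_nonneg_left (by positivity)
  · have ha : 0 < a := hb.trans_le hba
    have scale {x : ℝ} (hx : 0 ≤ x) := rpow_eq_rpow_mul_div_rpow ha hx
    have close {x : ℝ} (hx : |x - a| ≤ b) : |x / a - 1| ≤ b / a := by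
      rw [div_sub_one ha.ne', abs_div, abs_of_pos ha]
      gcongr
    have huv := huv hb hba
    rw [scale hu α, scale hv α, ← mul_add] at huv
    have h := normalized (b / a) (u / a) (v / a) (by positivity) (div_le_one_of_le₀ hba ha.le)
      (by positivity) (by positivity) (close hua) (close hva)
      (le_of_mul_le_mul_left huv (by positivity))
    calc u ^ (α * β) + v ^ (α * β) = a ^ (α * β) * ((u / a) ^ (α * β) + (v / a) ^ (α * β)) := by
          rw [mul_add, ← scale hu, ← scale hv]
      _ ≤ a ^ (α * β) * (2 + C' * (b / a) ^ p) := by gcongr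
      _ = 2 * a ^ (α * β) + C' * (a ^ (α * β - p) * b ^ p) := by
          rw [Real.rpow_sub ha, scale hb.le p]
          field_simp
      _ ≤ _ := by
          gcongr
          · exact le_add_of_nonneg_right (by positivity)
          · exact le_add_of_nonneg_right (by positivity)

end ScalarInequalities

section SmoothSeminorms

variable {B : Type w} [NormedAddCommGroup B] [NormedSpace ℝ B]

/-- The `p`-th power of a seminorm, with values in `[0, ∞]`. -/
noncomputable def seminormPow (nu : Seminorm ℝ B) (p : ℝ) (x : B) : ℝ≥0∞ :=
  ENNReal.ofReal (nu x) ^ p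

/-- The `p`-th power of the norm of `f` in the Bochner space `L ^ p (ν; B)`, where `B` carries the
seminorm `nu`. -/
noncomputable def lpPow {Y : Type*} [MeasurableSpace Y] (nu : Seminorm ℝ B) (p : ℝ)
    (ν : Measure Y) (f : Y → B) : ℝ≥0∞ :=
  ∫⁻ y, seminormPow nu p (f y) ∂ν

/-- The two-point smoothness inequality of power type `p`, with constant `C`. It is the inequality
through which the smoothness of `B` enters the moment estimates. -/
def IsTwoPointSmooth (nu : Seminorm ℝ B) (p : ℝ) (C : ℝ≥0) : Prop :=
  ∀ x y, seminormPow nu p (x + y) + seminormPow nu p (x - y) ≤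
    2 * seminormPow nu p x + C * seminormPow nu p y

/-- The two-point smoothness inequality for the `p * σ`-th power of the norm of `L ^ p (ν; B)`,
with constant `C`. -/
def IsLpSmooth {Y : Type*} [MeasurableSpace Y] [MeasurableSpace B] (nu : Seminorm ℝ B) (p σ : ℝ)
    (C : ℝ≥0) (ν : Measure Y) : Prop :=
  ∀ f g : Y → B, Measurable f → Measurable g →
    lpPow nu p ν (f + g) ^ σ + lpPow nu p ν (f - g) ^ σ ≤
      2 * lpPow nu p ν f ^ σ +
        C * (lpPow nu p ν f ^ (σ - 1) * lpPow nu p ν g + lpPow nu p ν g ^ σ)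

variable {nu : Seminorm ℝ B} {p : ℝ}

theorem seminormPow_eq_ofReal (hp : 0 ≤ p) (x : B) :
    seminormPow nu p x = ENNReal.ofReal (nu x ^ p) :=
  ENNReal.ofReal_rpow_of_nonneg (apply_nonneg nu x) hp

theorem seminormPow_zero (hp : 0 < p) : seminormPow nu p 0 = 0 := by simp [seminormPow, hp]

theorem seminormPow_neg (x : B) : seminormPow nu p (-x) = seminormPow nu p x := by
  simp [seminormPow]

theorem measurable_seminormPow [MeasurableSpace B] [BorelSpace B] (hnu : Continuous nu) :
    Measurable (seminormPow nu p) :=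
  (ENNReal.measurable_ofReal.comp hnu.measurable).pow_const _

theorem lpPow_neg {Y : Type*} [MeasurableSpace Y] {ν : Measure Y} (f : Y → B) :
    lpPow nu p ν (-f) = lpPow nu p ν f := by
  simp only [lpPow, Pi.neg_apply, seminormPow_neg]

theorem lpPow_add_rpow_le [MeasurableSpace B] [BorelSpace B] (hnu : Continuous nu) (hp : 1 ≤ p)
    {Y : Type*} [MeasurableSpace Y] {ν : Measure Y} {f g : Y → B} (hf : Measurable f)
    (hg : Measurable g) :
    lpPow nu p ν (f + g) ^ (1 / p) ≤ lpPow nu p ν f ^ (1 / p) + lpPow nu p ν g ^ (1 / p) := by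
  have hnorm {k : Y → B} (hk : Measurable k) :
      AEMeasurable (fun y => ENNReal.ofReal (nu (k y))) ν :=
    (ENNReal.measurable_ofReal.comp (hnu.measurable.comp hk)).aemeasurable
  refine le_trans ?_ (ENNReal.lintegral_Lp_add_le (hnorm hf) (hnorm hg) hp)
  refine ENNReal.rpow_le_rpow (lintegral_mono fun y => ?_) (by positivity)
  simp only [seminormPow, Pi.add_apply,
    ← ENNReal.ofReal_add (apply_nonneg nu (f y)) (apply_nonneg nu (g y))]
  gcongr
  exact map_add_le_add nu (f y) (g y)

theorem nu_add_add_nu_sub_le {r C : ℝ} (hpr : p ≤ r)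
    (h : ∀ t : ℝ, 0 < t → ∀ x y : B, nu x = 1 → nu y = 1 →
      (nu (x + t • y) + nu (x - t • y) - 2) / t ^ r ≤ C)
    {x y : B} (hy : 0 < nu y) (hyx : nu y ≤ nu x) :
    nu (x + y) + nu (x - y) ≤ nu x * (2 + |C| * (nu y / nu x) ^ p) := by
  have hx : 0 < nu x := hy.trans_le hyx
  have unit (z : B) (hz : 0 < nu z) : nu ((nu z)⁻¹ • z) = 1 := by
    rw [map_smul_eq_mul, Real.norm_of_nonneg (by positivity), inv_mul_cancel₀ hz.ne']
  have smooth := h (nu y / nu x) (by positivity) _ _ (unit x hx) (unit y hy)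
  rw [smul_smul, div_mul_eq_mul_div, mul_inv_cancel₀ hy.ne', one_div, ← smul_add, ← smul_sub,
    map_smul_eq_mul, map_smul_eq_mul, Real.norm_of_nonneg (by positivity), ← mul_add,
    div_le_iff₀ (by positivity), sub_le_iff_le_add', inv_mul_le_iff₀ hx] at smooth
  refine smooth.trans ?_
  gcongr nu x * (2 + ?_ * ?_)
  · exact le_abs_self C
  · exact Real.rpow_le_rpow_of_exponent_ge (by positivity) (div_le_one_of_le₀ hyx hx.le) hpr

theorem exists_isTwoPointSmooth {r C : ℝ} (hp : 1 ≤ p) (hpr : p ≤ r) (hr : r ≤ 2)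
    (h : ∀ t : ℝ, 0 < t → ∀ x y : B, nu x = 1 → nu y = 1 →
      (nu (x + t • y) + nu (x - t • y) - 2) / t ^ r ≤ C) :
    ∃ C', IsTwoPointSmooth nu p C' := by
  obtain ⟨C', hC', rpow⟩ := exists_two_point_rpow 1 p p |C| zero_le_one hp (hpr.trans hr)
    (abs_nonneg C)
  refine ⟨2 * C'.toNNReal, fun x y => ?_⟩
  have nu_nonneg (z : B) : 0 ≤ nu z := apply_nonneg nu z
  have key := rpow (nu x) (nu y) (nu (x + y)) (nu (x - y)) (nu_nonneg _) (nu_nonneg _)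
    (nu_nonneg _) (nu_nonneg _) (by simpa using abs_sub_map_le_sub nu (x + y) x)
    (by simpa using abs_sub_map_le_sub nu (x - y) x)
    fun hy hyx => by simpa only [Real.rpow_one] using nu_add_add_nu_sub_le hpr h hy hyx
  simp only [one_mul, sub_self, Real.rpow_zero, ← two_mul, ← mul_assoc] at key
  simp only [seminormPow_eq_ofReal (zero_le_one.trans hp)]
  calc ENNReal.ofReal (nu (x + y) ^ p) + ENNReal.ofReal (nu (x - y) ^ p)
      = ENNReal.ofReal (nu (x + y) ^ p + nu (x - y) ^ p) :=
        (ENNReal.ofReal_add (by positivity) (by positivity)).symm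
    _ ≤ ENNReal.ofReal (2 * nu x ^ p + 2 * C' * nu y ^ p) :=
        ENNReal.ofReal_le_ofReal (by linarith)
    _ = _ := by
        rw [ENNReal.ofReal_add (by positivity) (by positivity), ENNReal.ofReal_mul zero_le_two,
          ENNReal.ofReal_mul (by positivity), ENNReal.ofReal_mul zero_le_two]
        simp [ENNReal.ofReal]

theorem IsRSmooth.exists_seminorm {r : ℝ} (hB : IsRSmooth B r) (hp : 1 ≤ p) (hpr : p ≤ r)
    (hr : r ≤ 2) :
    ∃ nu : Seminorm ℝ B, Continuous nu ∧ (∃ C, IsTwoPointSmooth nu p C) ∧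
      ∃ A : ℝ≥0, ∀ x, seminormPow nu p x ≤ A * ‖x‖ₑ ^ p ∧ ‖x‖ₑ ^ p ≤ A * seminormPow nu p x := by
  obtain ⟨nu, ⟨a, b, ha, hb, hab⟩, C, hC⟩ := hB
  have hp0 : 0 ≤ p := zero_le_one.trans hp
  refine ⟨nu, ?_, exists_isTwoPointSmooth hp hpr hr hC, ((max a⁻¹ b) ^ p).toNNReal, fun x => ?_⟩
  · refine Seminorm.continuous_of_le (q := b.toNNReal • normSeminorm ℝ B)
      (continuous_norm.const_smul b.toNNReal) fun x => ?_
    simpa [NNReal.smul_def, Real.coe_toNNReal b hb.le] using (hab x).2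
  · have hmax : 0 ≤ max a⁻¹ b := hb.le.trans (le_max_right _ _)
    have upper : nu x ≤ max a⁻¹ b * ‖x‖ :=
      (hab x).2.trans (mul_le_mul_of_nonneg_right (le_max_right _ _) (norm_nonneg x))
    have lower : ‖x‖ ≤ max a⁻¹ b * nu x :=
      ((le_inv_mul_iff₀ ha).2 (hab x).1).trans
        (mul_le_mul_of_nonneg_right (le_max_left _ _) (apply_nonneg nu x))
    have rpow_mul (s t : ℝ) (h : s ≤ max a⁻¹ b * t) :
        ENNReal.ofReal s ^ p ≤ ENNReal.ofReal (max a⁻¹ b ^ p) * ENNReal.ofReal t ^ p := by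
      rw [← ENNReal.ofReal_rpow_of_nonneg hmax hp0, ← ENNReal.mul_rpow_of_nonneg _ _ hp0,
        ← ENNReal.ofReal_mul hmax]
      gcongr
    rw [← ofReal_norm]
    exact ⟨rpow_mul _ _ upper, rpow_mul _ _ lower⟩

theorem exists_two_point_nnreal_rpow (p σ : ℝ) (C : ℝ≥0) (hp : 0 < p) (hp2 : p ≤ 2) (hσ : 1 ≤ σ) :
    ∃ C' : ℝ≥0, ∀ W w U V : ℝ≥0,
      U ^ (1 / p) ≤ W ^ (1 / p) + w ^ (1 / p) → W ^ (1 / p) ≤ U ^ (1 / p) + w ^ (1 / p) →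
      V ^ (1 / p) ≤ W ^ (1 / p) + w ^ (1 / p) → W ^ (1 / p) ≤ V ^ (1 / p) + w ^ (1 / p) →
      U + V ≤ 2 * W + C * w →
      U ^ σ + V ^ σ ≤ 2 * W ^ σ + C' * (W ^ (σ - 1) * w + w ^ σ) := by
  obtain ⟨C', hC', rpow⟩ := exists_two_point_rpow p σ p C hp.le hσ hp2 C.coe_nonneg
  lift C' to ℝ≥0 using hC'
  refine ⟨C', fun W w U V hUW hWU hVW hWV hsum => ?_⟩
  simp only [← NNReal.coe_le_coe, NNReal.coe_add, NNReal.coe_mul, NNReal.coe_rpow,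
    NNReal.coe_ofNat] at *
  have root (x : ℝ≥0) (γ : ℝ) : ((x : ℝ) ^ (1 / p)) ^ (p * γ) = (x : ℝ) ^ γ := by
    rw [← Real.rpow_mul x.coe_nonneg]
    congr 1
    field_simp
  have root_p (x : ℝ≥0) : ((x : ℝ) ^ (1 / p)) ^ p = x := by simpa using root x 1
  have key := rpow ((W : ℝ) ^ (1 / p)) ((w : ℝ) ^ (1 / p)) ((U : ℝ) ^ (1 / p)) ((V : ℝ) ^ (1 / p))
    (by positivity) (by positivity) (by positivity) (by positivity)
    (abs_le.2 ⟨by linarith, by linarith⟩) (abs_le.2 ⟨by linarith, by linarith⟩) ?_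
  · simpa only [root, root_p, show p * σ - p = p * (σ - 1) by ring] using key
  · intro hw hwW
    have hW : (W : ℝ) ≠ 0 := by
      rintro hW
      simp only [hW, Real.zero_rpow (one_div_pos.2 hp).ne'] at hwW
      linarith
    rw [Real.div_rpow (by positivity) (by positivity)]
    simp only [root_p]
    calc (U : ℝ) + V ≤ 2 * W + C * w := hsum
      _ = W * (2 + C * (w / W)) := by field_simp

theorem exists_two_point_ennreal_rpow (p σ : ℝ) (C : ℝ≥0) (hp : 0 < p) (hp2 : p ≤ 2)
    (hσ : 1 ≤ σ) :
    ∃ C' : ℝ≥0, ∀ W w U V : ℝ≥0∞,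
      U ^ (1 / p) ≤ W ^ (1 / p) + w ^ (1 / p) → W ^ (1 / p) ≤ U ^ (1 / p) + w ^ (1 / p) →
      V ^ (1 / p) ≤ W ^ (1 / p) + w ^ (1 / p) → W ^ (1 / p) ≤ V ^ (1 / p) + w ^ (1 / p) →
      U + V ≤ 2 * W + C * w →
      U ^ σ + V ^ σ ≤ 2 * W ^ σ + C' * (W ^ (σ - 1) * w + w ^ σ) := by
  have hσ0 : 0 < σ := zero_lt_one.trans_le hσ
  obtain ⟨C', nnreal⟩ := exists_two_point_nnreal_rpow p σ C hp hp2 hσ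
  refine ⟨C' + 1, fun W w U V hUW hWU hVW hWV hsum => ?_⟩
  by_cases hW : W = ∞
  · simp [hW, ENNReal.top_rpow_of_pos hσ0, ENNReal.mul_top]
  by_cases hw : w = ∞
  · simp [hw, ENNReal.top_rpow_of_pos hσ0, ENNReal.mul_top]
  have hUV : U + V ≠ ∞ := ne_top_of_le_ne_top (by finiteness) hsum
  lift W to ℝ≥0 using hW
  lift w to ℝ≥0 using hw
  lift U to ℝ≥0 using (ENNReal.add_ne_top.1 hUV).1
  lift V to ℝ≥0 using (ENNReal.add_ne_top.1 hUV).2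
  simp only [← ENNReal.coe_rpow_of_nonneg _ (one_div_nonneg.2 hp.le),
    ← ENNReal.coe_rpow_of_nonneg _ hσ0.le,
    ← ENNReal.coe_rpow_of_nonneg _ (sub_nonneg.2 hσ)] at *
  norm_cast at *
  refine (nnreal W w U V hUW hWU hVW hWV hsum).trans ?_
  gcongr
  exact le_self_add

theorem IsTwoPointSmooth.exists_isLpSmooth [MeasurableSpace B] [BorelSpace B]
    [SecondCountableTopology B] {C : ℝ≥0} (h : IsTwoPointSmooth nu p C) (hnu : Continuous nu)
    (hp1 : 1 ≤ p) (hp2 : p ≤ 2) {σ : ℝ} (hσ : 1 ≤ σ) :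
    ∃ C', ∀ (Y : Type v) [MeasurableSpace Y] (ν : Measure Y), IsLpSmooth nu p σ C' ν := by
  obtain ⟨C', two_point⟩ := exists_two_point_ennreal_rpow p σ C (zero_lt_one.trans_le hp1) hp2 hσ
  refine ⟨C', fun Y _ ν f g hf hg => ?_⟩
  apply two_point
  · exact lpPow_add_rpow_le hnu hp1 hf hg
  · simpa [lpPow_neg] using lpPow_add_rpow_le (ν := ν) hnu hp1 (hf.add hg) hg.neg
  · simpa [lpPow_neg, sub_eq_add_neg] using lpPow_add_rpow_le (ν := ν) hnu hp1 hf hg.neg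
  · simpa using lpPow_add_rpow_le (ν := ν) hnu hp1 (hf.sub hg) hg
  · have hmeas {k : Y → B} (hk : Measurable k) : Measurable fun y => seminormPow nu p (k y) :=
      (measurable_seminormPow hnu).comp hk
    simp only [lpPow]
    rw [← lintegral_add_left (hmeas (hf.add hg)), ← lintegral_const_mul _ (hmeas hf),
      ← lintegral_const_mul _ (hmeas hg), ← lintegral_add_left ((hmeas hf).const_mul _)]
    exact lintegral_mono fun y => h _ _

theorem rpow_lintegral_le_lintegral_rpow {T : Type*} [MeasurableSpace T] {μ : Measure T}
    [IsProbabilityMeasure μ] {f : T → ℝ≥0∞} (hf : AEMeasurable f μ) {s : ℝ} (hs : 1 ≤ s) :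
    (∫⁻ t, f t ∂μ) ^ s ≤ ∫⁻ t, f t ^ s ∂μ := by
  rcases hs.eq_or_lt with rfl | hs
  · simp
  have holder := ENNReal.lintegral_mul_le_Lp_mul_Lq μ (Real.HolderConjugate.conjExponent hs) hf
    (aemeasurable_const (b := (1 : ℝ≥0∞)))
  simp only [Pi.mul_apply, mul_one, ENNReal.one_rpow, lintegral_const, measure_univ] at holder
  rwa [← ENNReal.le_rpow_inv_iff (zero_lt_one.trans hs), ← one_div]

theorem seminormPow_integral_le [CompleteSpace B] (hnu : Continuous nu) (hp : 1 ≤ p)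
    {T : Type*} [MeasurableSpace T] {μ : Measure T} [IsProbabilityMeasure μ] {f : T → B}
    (hf : Integrable f μ) :
    seminormPow nu p (∫ t, f t ∂μ) ≤ ∫⁻ t, seminormPow nu p (f t) ∂μ := by
  obtain ⟨A, -, hA⟩ := nu.bound_of_continuous_normedSpace hnu
  have nu_meas : AEStronglyMeasurable (fun t => nu (f t)) μ :=
    hnu.comp_aestronglyMeasurable hf.aestronglyMeasurable
  have nu_integrable : Integrable (fun t => nu (f t)) μ :=
    (hf.norm.const_mul A).mono' nu_meas
      (.of_forall fun t => by simpa [abs_of_nonneg (apply_nonneg nu _)] using hA (f t))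
  have jensen : nu (∫ t, f t ∂μ) ≤ ∫ t, nu (f t) ∂μ :=
    nu.convexOn.map_integral_le hnu.continuousOn isClosed_univ (.of_forall fun _ => Set.mem_univ _)
      hf nu_integrable
  calc seminormPow nu p (∫ t, f t ∂μ) ≤ (∫⁻ t, ENNReal.ofReal (nu (f t)) ∂μ) ^ p := by
        rw [← ofReal_integral_eq_lintegral_ofReal nu_integrable
          (.of_forall fun _ => apply_nonneg nu _)]
        exact ENNReal.rpow_le_rpow (ENNReal.ofReal_le_ofReal jensen) (by positivity)
    _ ≤ _ := rpow_lintegral_le_lintegral_rpow nu_meas.aemeasurable.ennreal_ofReal hp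

/-- The random functions `D t : Y → B`, with `t` distributed according to `μ`, are centered at each
point of `Y`. -/
structure IsCentered {T Y : Type*} [MeasurableSpace T] [MeasurableSpace Y] [MeasurableSpace B]
    (μ : Measure T) (D : T → Y → B) : Prop where
  measurable : Measurable (Function.uncurry D)
  integrable : ∀ y, Integrable (fun t => D t y) μ
  integral_eq_zero : ∀ y, ∫ t, D t y ∂μ = 0

variable [MeasurableSpace B] [BorelSpace B]
  {T Y : Type*} [MeasurableSpace T] [MeasurableSpace Y] {μ : Measure T} {ν : Measure Y}
  {f : Y → B} {D : T → Y → B}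

theorem IsCentered.neg (hD : IsCentered μ D) : IsCentered μ (-D) where
  measurable := hD.measurable.neg
  integrable y := (hD.integrable y).neg
  integral_eq_zero y := by simp [integral_neg, hD.integral_eq_zero y]

theorem measurable_lpPow [SFinite ν] (hnu : Continuous nu) (hD : Measurable (Function.uncurry D)) :
    Measurable fun t => lpPow nu p ν (D t) :=
  ((measurable_seminormPow hnu).comp hD).lintegral_prod_right'

variable [SecondCountableTopology B] [CompleteSpace B] [SFinite ν] [IsProbabilityMeasure μ] {σ : ℝ}

theorem IsCentered.lpPow_le_lintegral_lpPow_add (hD : IsCentered μ D) (hnu : Continuous nu)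
    (hp : 1 ≤ p) (hf : Measurable f) :
    lpPow nu p ν f ≤ ∫⁻ t, lpPow nu p ν (f + D t) ∂μ := by
  have hmeas : Measurable (Function.uncurry fun t y => seminormPow nu p ((f + D t) y)) :=
    (measurable_seminormPow hnu).comp ((hf.comp measurable_snd).add hD.measurable)
  simp only [lpPow]
  rw [lintegral_lintegral_swap hmeas.aemeasurable]
  refine lintegral_mono fun y => ?_
  have jensen := seminormPow_integral_le hnu hp ((integrable_const (f y)).add (hD.integrable y))
  rw [integral_add' (integrable_const _) (hD.integrable y), hD.integral_eq_zero y] at jensen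
  simpa using jensen

theorem IsCentered.rpow_lpPow_le_lintegral_rpow (hD : IsCentered μ D) (hnu : Continuous nu)
    (hp : 1 ≤ p) (hσ : 1 ≤ σ) (hf : Measurable f) :
    lpPow nu p ν f ^ σ ≤ ∫⁻ t, lpPow nu p ν (f + D t) ^ σ ∂μ :=
  (ENNReal.rpow_le_rpow (hD.lpPow_le_lintegral_lpPow_add hnu hp hf) (zero_le_one.trans hσ)).trans
    (rpow_lintegral_le_lintegral_rpow
      (measurable_lpPow hnu ((hf.comp measurable_snd).add hD.measurable)).aemeasurable hσ)

/-- The two-point inequality is integrated over `D t`; by centering, the average over `f - D t` is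
at least the term at `f`. -/
theorem IsCentered.lintegral_rpow_lpPow_add_le (hD : IsCentered μ D) (hnu : Continuous nu)
    (hp : 1 ≤ p) (hσ : 1 ≤ σ) {C : ℝ≥0} (hC : IsLpSmooth nu p σ C ν) (hf : Measurable f) :
    ∫⁻ t, lpPow nu p ν (f + D t) ^ σ ∂μ ≤
      lpPow nu p ν f ^ σ + C * (lpPow nu p ν f ^ (σ - 1) * ∫⁻ t, lpPow nu p ν (D t) ∂μ +
        ∫⁻ t, lpPow nu p ν (D t) ^ σ ∂μ) := by
  by_cases hW : lpPow nu p ν f ^ σ = ∞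
  · simp [hW]
  have hmD : Measurable fun t => lpPow nu p ν (D t) := measurable_lpPow hnu hD.measurable
  have hmadd : Measurable fun t => lpPow nu p ν (f + D t) :=
    measurable_lpPow hnu ((hf.comp measurable_snd).add hD.measurable)
  have two_point : ∫⁻ t, lpPow nu p ν (f + D t) ^ σ ∂μ + ∫⁻ t, lpPow nu p ν (f - D t) ^ σ ∂μ ≤
      2 * lpPow nu p ν f ^ σ + C * (lpPow nu p ν f ^ (σ - 1) * ∫⁻ t, lpPow nu p ν (D t) ∂μ +
        ∫⁻ t, lpPow nu p ν (D t) ^ σ ∂μ) := by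
    have := lintegral_mono (μ := μ) fun t => hC f (D t) hf hD.measurable.of_uncurry_left
    rwa [lintegral_add_left (hmadd.pow_const _), lintegral_add_left measurable_const,
      lintegral_const, measure_univ, mul_one,
      lintegral_const_mul' _ _ ENNReal.coe_ne_top,
      lintegral_add_left (hmD.const_mul _), lintegral_const_mul _ hmD] at this
  have centered : lpPow nu p ν f ^ σ ≤ ∫⁻ t, lpPow nu p ν (f - D t) ^ σ ∂μ := by
    simpa only [sub_eq_add_neg, Pi.neg_apply]
      using hD.neg.rpow_lpPow_le_lintegral_rpow hnu hp hσ hf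
  have := (add_le_add_right centered _).trans two_point
  rw [two_mul, add_assoc, add_comm] at this
  exact ENNReal.le_of_add_le_add_left hW this

end SmoothSeminorms

section ProductSpaces

variable {ι : Type*} [DecidableEq ι] {S : ι → Type*} [∀ i, MeasurableSpace (S i)]

theorem measurable_update_prodMk (i : ι) :
    Measurable fun z : (∀ j, S j) × S i => Function.update z.1 i z.2 := by
  refine measurable_pi_iff.2 fun j => ?_
  rcases eq_or_ne j i with rfl | hj
  · simpa using measurable_snd
  · simp only [Function.update_of_ne hj]
    exact (measurable_pi_apply j).comp measurable_fst

variable (μ : ∀ i, Measure (S i)) [∀ i, IsProbabilityMeasure (μ i)]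

theorem measurePreserving_update_infinitePi (i : ι) :
    MeasurePreserving (fun z : (∀ j, S j) × S i => Function.update z.1 i z.2)
      ((Measure.infinitePi μ).prod (μ i)) (Measure.infinitePi μ) := by
  have hm := measurable_update_prodMk (S := S) i
  refine ⟨hm, Measure.eq_infinitePi _ fun s t ht => ?_⟩
  rw [Measure.map_apply hm (.pi s.countable_toSet fun j _ => ht j)]
  by_cases hi : i ∈ s
  · have preimage_eq : (fun z : (∀ j, S j) × S i => Function.update z.1 i z.2) ⁻¹' (Set.pi s t) =
        (Set.pi (s.erase i : Finset ι) t) ×ˢ t i := by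
      ext z
      simp only [Set.mem_preimage, Set.mem_pi, Set.mem_prod, Finset.mem_coe, Finset.mem_erase]
      refine ⟨fun h => ⟨fun j hj => by simpa [hj.1] using h j hj.2, by simpa using h i hi⟩, ?_⟩
      rintro ⟨off, at_i⟩ j hj
      rcases eq_or_ne j i with rfl | hji
      · simpa using at_i
      · simpa [hji] using off j ⟨hji, hj⟩
    rw [preimage_eq, Measure.prod_prod, Measure.infinitePi_pi _ fun j _ => ht j,
      Finset.prod_erase_mul _ _ hi]
  · have preimage_eq : (fun z : (∀ j, S j) × S i => Function.update z.1 i z.2) ⁻¹' (Set.pi s t) =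
        (Set.pi s t) ×ˢ Set.univ := by
      ext z
      simp only [Set.mem_preimage, Set.mem_pi, Set.mem_prod, Finset.mem_coe, Set.mem_univ, and_true]
      exact forall₂_congr fun j hj => by rw [Function.update_of_ne (ne_of_mem_of_not_mem hj hi)]
    rw [preimage_eq, Measure.prod_prod, Measure.infinitePi_pi _ fun j _ => ht j, measure_univ,
      mul_one]

theorem lintegral_infinitePi_update (i : ι) {F : (∀ j, S j) → ℝ≥0∞} (hF : Measurable F) :
    ∫⁻ x, F x ∂Measure.infinitePi μ =
      ∫⁻ x, ∫⁻ t, F (Function.update x i t) ∂μ i ∂Measure.infinitePi μ := by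
  have h := measurePreserving_update_infinitePi μ i
  rw [← h.lintegral_comp hF]
  exact lintegral_prod _ (hF.comp h.measurable).aemeasurable

omit [∀ i, MeasurableSpace (S i)] in
theorem update_eq_of_dependsOn {β : Type*} {F : (∀ j, S j) → β} {s : Set ι} (hF : DependsOn F s)
    {i : ι} (hi : i ∉ s) (x : ∀ j, S j) (t : S i) : F (Function.update x i t) = F x :=
  hF fun _ hj => Function.update_of_ne (ne_of_mem_of_not_mem hj hi) _ _

end ProductSpaces

section Doob

variable {S : ℕ → Type*} [∀ n, MeasurableSpace (S n)]

/-- A `[0, ∞]`-valued submartingale on a product space, with respect to the filtration generated by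
the coordinates: `X n` depends on the coordinates before the `n`-th only, and is dominated by the
average of `X (n + 1)` over the `n`-th coordinate. -/
structure IsProductSubmartingale (μ : ∀ n, Measure (S n)) (X : ℕ → (∀ n, S n) → ℝ≥0∞) : Prop where
  measurable : ∀ n, Measurable (X n)
  dependsOn : ∀ n, DependsOn (X n) (Set.Iio n)
  le_lintegral_update : ∀ n x, X n x ≤ ∫⁻ t, X (n + 1) (Function.update x n t) ∂μ n

theorem measurable_partialSups {T : Type*} [MeasurableSpace T] {X : ℕ → T → ℝ≥0∞}
    (hX : ∀ n, Measurable (X n)) (n : ℕ) : Measurable (partialSups X n) := by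
  induction n with
  | zero => simpa using hX 0
  | succ n ih => simpa only [partialSups_add_one] using ih.sup (hX (n + 1))

theorem lintegral_partialSups_rpow_ne_top {T : Type*} [MeasurableSpace T] {P : Measure T}
    {X : ℕ → T → ℝ≥0∞} (hX : ∀ n, Measurable (X n)) {σ : ℝ} {n : ℕ}
    (hfin : ∀ k ≤ n, ∫⁻ x, X k x ^ σ ∂P ≠ ∞) : ∫⁻ x, partialSups X n x ^ σ ∂P ≠ ∞ := by
  induction n with
  | zero => simpa using hfin 0 le_rfl
  | succ n ih =>
    refine ne_top_of_le_ne_top (ENNReal.add_ne_top.2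
      ⟨ih fun k hk => hfin k (hk.trans n.le_succ), hfin (n + 1) le_rfl⟩) ?_
    rw [← lintegral_add_left ((measurable_partialSups hX n).pow_const σ)]
    refine lintegral_mono fun x => ?_
    rw [partialSups_add_one, Pi.sup_apply]
    rcases max_choice (partialSups X n x) (X (n + 1) x) with h | h <;> rw [h]
    · exact le_self_add
    · exact le_add_self

theorem ofReal_mul_rpow_sub_one_mul_le {σ : ℝ} (hσ : 1 < σ) (a b : ℝ≥0∞) :
    ENNReal.ofReal σ * (a ^ (σ - 1) * b) ≤ ENNReal.ofReal (σ - 1) * a ^ σ + b ^ σ := by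
  have conj : σ.conjExponent.HolderConjugate σ := (Real.HolderConjugate.conjExponent hσ).symm
  have young := ENNReal.young_inequality (a ^ (σ - 1)) b conj
  have hσ0 : 0 < σ := zero_lt_one.trans hσ
  have hσ1 : 0 < σ - 1 := sub_pos.2 hσ
  rw [← ENNReal.rpow_mul, conj.symm.sub_one_mul_conj, Real.conjExponent,
    ENNReal.ofReal_div_of_pos hσ1] at young
  refine (mul_le_mul_right young _).trans_eq ?_
  have h0 : ENNReal.ofReal σ ≠ 0 := by simpa using hσ0
  rw [mul_add, ENNReal.mul_div_cancel h0 ENNReal.ofReal_ne_top]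
  congr 1
  rw [ENNReal.div_eq_inv_mul, ENNReal.inv_div (.inl ENNReal.ofReal_ne_top)
    (.inl (by simpa using hσ1)), ← mul_assoc, ENNReal.mul_div_cancel h0 ENNReal.ofReal_ne_top]

theorem rpow_sub_one_mul_self {σ : ℝ} (hσ : 1 ≤ σ) (b : ℝ≥0∞) : b ^ (σ - 1) * b = b ^ σ := by
  nth_rw 2 [← ENNReal.rpow_one b]
  rw [← ENNReal.rpow_add_of_nonneg _ _ (sub_nonneg.2 hσ) zero_le_one, sub_add_cancel]

/-- Young's inequality if `a ≤ b`; both sides agree otherwise. -/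
theorem doob_pointwise {σ : ℝ} (hσ : 1 < σ) (a b : ℝ≥0∞) :
    ENNReal.ofReal (σ - 1) * max a b ^ σ + ENNReal.ofReal σ * (a ^ (σ - 1) * b) ≤
      ENNReal.ofReal (σ - 1) * a ^ σ + ENNReal.ofReal σ * (max a b ^ (σ - 1) * b) := by
  rcases le_total b a with h | h
  · rw [max_eq_left h]
  have ofReal_eq : ENNReal.ofReal σ = ENNReal.ofReal (σ - 1) + 1 := by
    rw [← ENNReal.ofReal_one, ← ENNReal.ofReal_add (sub_nonneg.2 hσ.le) zero_le_one, sub_add_cancel]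
  rw [max_eq_right h, rpow_sub_one_mul_self hσ.le]
  calc _ ≤ ENNReal.ofReal (σ - 1) * b ^ σ + (ENNReal.ofReal (σ - 1) * a ^ σ + b ^ σ) := by
        gcongr
        exact ofReal_mul_rpow_sub_one_mul_le hσ a b
    _ = _ := by rw [ofReal_eq]; ring

section

variable {T : Type*} [MeasurableSpace T] {P : Measure T} {σ : ℝ} {f g : T → ℝ≥0∞}

theorem lintegral_rpow_sub_one_mul_le (hσ : 1 < σ) (hf : Measurable f) (hg : Measurable g) :
    ENNReal.ofReal σ * ∫⁻ x, f x ^ (σ - 1) * g x ∂P ≤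
      ENNReal.ofReal (σ - 1) * ∫⁻ x, f x ^ σ ∂P + ∫⁻ x, g x ^ σ ∂P := by
  have hmul : Measurable fun x => f x ^ (σ - 1) * g x := (hf.pow_const _).mul hg
  rw [← lintegral_const_mul _ hmul, ← lintegral_const_mul _ (hf.pow_const σ),
    ← lintegral_add_right _ (hg.pow_const σ)]
  exact lintegral_mono fun x => ofReal_mul_rpow_sub_one_mul_le hσ _ _

theorem lintegral_max_rpow_add_le (hσ : 1 < σ) (hf : Measurable f) (hg : Measurable g) :
    ENNReal.ofReal (σ - 1) * ∫⁻ x, (f ⊔ g) x ^ σ ∂P +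
        ENNReal.ofReal σ * ∫⁻ x, f x ^ (σ - 1) * g x ∂P ≤
      ENNReal.ofReal (σ - 1) * ∫⁻ x, f x ^ σ ∂P +
        ENNReal.ofReal σ * ∫⁻ x, (f ⊔ g) x ^ (σ - 1) * g x ∂P := by
  have hfg : Measurable (f ⊔ g) := hf.sup hg
  have hmul : Measurable fun x => f x ^ (σ - 1) * g x := (hf.pow_const _).mul hg
  have hmul_sup : Measurable fun x => (f ⊔ g) x ^ (σ - 1) * g x := (hfg.pow_const _).mul hg
  rw [← lintegral_const_mul _ (hfg.pow_const σ), ← lintegral_const_mul _ (hf.pow_const σ),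
    ← lintegral_const_mul _ hmul, ← lintegral_const_mul _ hmul_sup,
    ← lintegral_add_left ((hfg.pow_const σ).const_mul _),
    ← lintegral_add_left ((hf.pow_const σ).const_mul _)]
  exact lintegral_mono fun x => doob_pointwise hσ _ _

end

namespace IsProductSubmartingale

variable {μ : ∀ n, Measure (S n)} [∀ n, IsProbabilityMeasure (μ n)] {X : ℕ → (∀ n, S n) → ℝ≥0∞}
  {σ : ℝ} {k n : ℕ}

theorem lintegral_mul_le_succ (hX : IsProductSubmartingale μ X) {G : (∀ n, S n) → ℝ≥0∞}
    (hG : Measurable G) (hGn : DependsOn G (Set.Iio n)) :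
    ∫⁻ x, G x * X n x ∂Measure.infinitePi μ ≤ ∫⁻ x, G x * X (n + 1) x ∂Measure.infinitePi μ := by
  rw [lintegral_infinitePi_update μ n (F := fun x => G x * X (n + 1) x)
    (hG.mul (hX.measurable (n + 1)))]
  refine lintegral_mono fun x => ?_
  have hmeas : Measurable fun t => X (n + 1) (Function.update x n t) :=
    (hX.measurable (n + 1)).comp (measurable_update x)
  simp only [update_eq_of_dependsOn hGn (Set.self_notMem_Iio)]
  rw [lintegral_const_mul _ hmeas]
  gcongr
  exact hX.le_lintegral_update n x

theorem monotone_lintegral_rpow (hX : IsProductSubmartingale μ X) (hσ : 1 ≤ σ) :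
    Monotone fun n => ∫⁻ x, X n x ^ σ ∂Measure.infinitePi μ := by
  refine monotone_nat_of_le_succ fun n => ?_
  rw [lintegral_infinitePi_update μ n ((hX.measurable (n + 1)).pow_const σ)]
  refine lintegral_mono fun x => ?_
  refine (ENNReal.rpow_le_rpow (hX.le_lintegral_update n x) (zero_le_one.trans hσ)).trans ?_
  exact rpow_lintegral_le_lintegral_rpow
    ((hX.measurable (n + 1)).comp (measurable_update x)).aemeasurable hσ

omit [∀ n, IsProbabilityMeasure (μ n)] in
theorem dependsOn_partialSups (hX : IsProductSubmartingale μ X) (n : ℕ) :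
    DependsOn (partialSups X n) (Set.Iio n) := by
  intro x y hxy
  simp only [Pi.partialSups_apply, partialSups_apply]
  refine Finset.sup'_congr _ rfl fun k hk => hX.dependsOn k fun i hi => hxy i ?_
  exact Set.mem_Iio.2 (lt_of_lt_of_le hi (Finset.mem_Iic.1 hk))

theorem lintegral_partialSups_rpow_le (hX : IsProductSubmartingale μ X) (hσ : 1 < σ)
    (hfin : ∫⁻ x, X n x ^ σ ∂Measure.infinitePi μ ≠ ∞) :
    ENNReal.ofReal (σ - 1) * ∫⁻ x, partialSups X n x ^ σ ∂Measure.infinitePi μ ≤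
      ENNReal.ofReal σ * ∫⁻ x, partialSups X n x ^ (σ - 1) * X n x ∂Measure.infinitePi μ := by
  induction n with
  | zero =>
    simp only [partialSups_zero, rpow_sub_one_mul_self hσ.le]
    gcongr
    linarith
  | succ n ih =>
    have hM := measurable_partialSups hX.measurable n
    have hXfin (k : ℕ) (hk : k ≤ n + 1) : ∫⁻ x, X k x ^ σ ∂Measure.infinitePi μ ≠ ∞ :=
      ne_top_of_le_ne_top hfin (hX.monotone_lintegral_rpow hσ.le hk)
    have ih := (ih (hXfin n n.le_succ)).trans (mul_le_mul_right (hX.lintegral_mul_le_succ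
      (hM.pow_const (σ - 1)) fun x y hxy => by rw [hX.dependsOn_partialSups n hxy]) _)
    have mixed_ne_top := ne_top_of_le_ne_top (ENNReal.add_ne_top.2
      ⟨ENNReal.mul_ne_top ENNReal.ofReal_ne_top (lintegral_partialSups_rpow_ne_top hX.measurable
        fun k hk => hXfin k (hk.trans n.le_succ)), hfin⟩)
      (lintegral_rpow_sub_one_mul_le hσ hM (hX.measurable (n + 1)))
    have step := (lintegral_max_rpow_add_le hσ hM (hX.measurable (n + 1))).trans
      (add_le_add_left ih _)
    rw [add_comm] at step
    simpa only [partialSups_add_one] using ENNReal.le_of_add_le_add_left mixed_ne_top step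

end IsProductSubmartingale

/-- The constant `(σ / (σ - 1)) ^ σ` of Doob's `L ^ σ` maximal inequality. -/
noncomputable def doobConst (σ : ℝ) : ℝ≥0 := (σ / (σ - 1)).toNNReal ^ σ

theorem le_rpow_mul_of_mul_le {σ : ℝ} (hσ : 1 < σ) {A B c : ℝ≥0∞} (hA : A ≠ ∞)
    (h : A ≤ c * (A ^ (1 / σ.conjExponent) * B ^ (1 / σ))) : A ≤ c ^ σ * B := by
  have conj := Real.HolderConjugate.conjExponent hσ
  rcases eq_or_ne A 0 with rfl | hA0
  · simp
  have split : A = A ^ (1 / σ.conjExponent) * A ^ (1 / σ) := by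
    rw [← ENNReal.rpow_add _ _ hA0 hA, add_comm, conj.one_div_add_one_div, one_div_one,
      ENNReal.rpow_one]
  have root : A ^ (1 / σ) ≤ c * B ^ (1 / σ) := by
    rw [mul_left_comm] at h
    nth_rw 1 [split] at h
    exact (ENNReal.mul_le_mul_iff_right (by simp [hA0, hA]) (by simp [hA0, hA])).1 h
  have := ENNReal.rpow_le_rpow root conj.nonneg
  rwa [ENNReal.mul_rpow_of_nonneg _ _ conj.nonneg, one_div, ENNReal.rpow_inv_rpow conj.ne_zero,
    ENNReal.rpow_inv_rpow conj.ne_zero] at this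

theorem IsProductSubmartingale.doob {μ : ∀ n, Measure (S n)} [∀ n, IsProbabilityMeasure (μ n)]
    {X : ℕ → (∀ n, S n) → ℝ≥0∞} (hX : IsProductSubmartingale μ X) {σ : ℝ} (hσ : 1 < σ) (n : ℕ) :
    ∫⁻ x, partialSups X n x ^ σ ∂Measure.infinitePi μ ≤
      doobConst σ * ∫⁻ x, X n x ^ σ ∂Measure.infinitePi μ := by
  have conj := Real.HolderConjugate.conjExponent hσ
  have hσ1 : 0 < σ - 1 := sub_pos.2 hσ
  by_cases hfin : ∫⁻ x, X n x ^ σ ∂Measure.infinitePi μ = ∞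
  · have : doobConst σ ≠ 0 := by
      simpa [doobConst, conj.ne_zero] using div_pos conj.pos hσ1
    simp [hfin, this]
  have hM := measurable_partialSups hX.measurable n
  have holder := ENNReal.lintegral_mul_le_Lp_mul_Lq (Measure.infinitePi μ) conj.symm
    (hM.pow_const (σ - 1)).aemeasurable (hX.measurable n).aemeasurable
  simp only [Pi.mul_apply, ← ENNReal.rpow_mul, conj.sub_one_mul_conj] at holder
  rw [doobConst, ENNReal.coe_rpow_of_nonneg _ conj.nonneg]
  refine le_rpow_mul_of_mul_le hσ (lintegral_partialSups_rpow_ne_top hX.measurable fun k hk =>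
    ne_top_of_le_ne_top hfin (hX.monotone_lintegral_rpow hσ.le hk)) ?_
  refine le_trans ?_ (mul_le_mul_right holder _)
  change _ ≤ ENNReal.ofReal (σ / (σ - 1)) * _
  rw [ENNReal.ofReal_div_of_pos hσ1, ← ENNReal.mul_div_right_comm,
    ENNReal.le_div_iff_mul_le (.inl (by simpa using hσ1)) (.inl ENNReal.ofReal_ne_top), mul_comm]
  exact hX.lintegral_partialSups_rpow_le hσ hfin

end Doob

section Rosenthal

theorem rpow_sub_one_mul_le {σ : ℝ} (hσ : 1 ≤ σ) {ε : ℝ≥0} (hε : 0 < ε) (a b : ℝ≥0∞) :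
    a ^ (σ - 1) * b ≤ ε * a ^ σ + (ε⁻¹ ^ (σ - 1) : ℝ≥0) * b ^ σ := by
  have hσ1 : 0 ≤ σ - 1 := sub_nonneg.2 hσ
  rcases le_total b (ε * a) with h | h
  · refine le_add_right ?_
    calc a ^ (σ - 1) * b ≤ a ^ (σ - 1) * (ε * a) := by gcongr
      _ = ε * a ^ σ := by rw [mul_left_comm, rpow_sub_one_mul_self hσ]
  · refine le_add_left ?_
    have ha : a ≤ (ε⁻¹ : ℝ≥0) * b := by
      rw [ENNReal.coe_inv hε.ne', ← ENNReal.div_eq_inv_mul]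
      exact (ENNReal.le_div_iff_mul_le (.inl (by simpa using hε.ne')) (.inl ENNReal.coe_ne_top)).2
        (by rwa [mul_comm])
    calc a ^ (σ - 1) * b ≤ ((ε⁻¹ : ℝ≥0) * b) ^ (σ - 1) * b := by gcongr
      _ = _ := by
        rw [ENNReal.mul_rpow_of_nonneg _ _ hσ1, mul_assoc, rpow_sub_one_mul_self hσ,
          ENNReal.coe_rpow_of_nonneg _ hσ1]

section Submartingale

variable {S : ℕ → Type*} [∀ n, MeasurableSpace (S n)] {μ : ∀ n, Measure (S n)}
  [∀ n, IsProbabilityMeasure (μ n)] {W V : ℕ → (∀ n, S n) → ℝ≥0∞} {σ : ℝ}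

theorem IsProductSubmartingale.sum_lintegral_rpow_sub_one_mul_le (hW : IsProductSubmartingale μ W)
    (hV : ∀ n, Measurable (V n)) (hσ : 1 ≤ σ) {ε : ℝ≥0} (hε : 0 < ε) (n : ℕ) :
    ∑ k ∈ Finset.range (n + 1), ∫⁻ x, W k x ^ (σ - 1) * V k x ∂Measure.infinitePi μ ≤
      ε * ∫⁻ x, W n x ^ σ ∂Measure.infinitePi μ + ((doobConst σ / ε) ^ (σ - 1) : ℝ≥0) *
        ∫⁻ x, (∑ k ∈ Finset.range (n + 1), V k x) ^ σ ∂Measure.infinitePi μ := by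
  set P := Measure.infinitePi μ
  have hWV (k : ℕ) : Measurable fun x => W k x ^ (σ - 1) * V k x :=
    ((hW.measurable k).pow_const _).mul (hV k)
  have hVsum : Measurable fun x => ∑ k ∈ Finset.range (n + 1), V k x :=
    Finset.measurable_sum _ fun k _ => hV k
  have hM := measurable_partialSups hW.measurable n
  rw [← lintegral_finsetSum _ fun k _ => hWV k]
  rcases hσ.eq_or_lt with rfl | hσ1
  · simp
  have hδ : 0 < ε / doobConst σ := div_pos hε
    (NNReal.rpow_pos (by simpa using div_pos (zero_lt_one.trans hσ1) (sub_pos.2 hσ1)))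
  calc ∫⁻ x, ∑ k ∈ Finset.range (n + 1), W k x ^ (σ - 1) * V k x ∂P
      ≤ ∫⁻ x, partialSups W n x ^ (σ - 1) * ∑ k ∈ Finset.range (n + 1), V k x ∂P := by
        refine lintegral_mono fun x => ?_
        rw [Finset.mul_sum]
        refine Finset.sum_le_sum fun k hk => ?_
        gcongr
        exact le_partialSups_of_le W (Finset.mem_range_succ_iff.1 hk) x
    _ ≤ ∫⁻ x, ((ε / doobConst σ : ℝ≥0) * partialSups W n x ^ σ +
          ((ε / doobConst σ)⁻¹ ^ (σ - 1) : ℝ≥0) *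
            (∑ k ∈ Finset.range (n + 1), V k x) ^ σ) ∂P :=
        lintegral_mono fun x => rpow_sub_one_mul_le hσ hδ _ _
    _ = (ε / doobConst σ : ℝ≥0) * ∫⁻ x, partialSups W n x ^ σ ∂P +
          ((doobConst σ / ε) ^ (σ - 1) : ℝ≥0) *
            ∫⁻ x, (∑ k ∈ Finset.range (n + 1), V k x) ^ σ ∂P := by
        rw [lintegral_add_left ((hM.pow_const σ).const_mul _), lintegral_const_mul _
          (hM.pow_const σ), lintegral_const_mul _ (hVsum.pow_const σ), inv_div]
    _ ≤ _ := by
        refine add_le_add_left ((mul_le_mul_right (hW.doob hσ1 n) _).trans_eq ?_) _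
        rw [← mul_assoc, ← ENNReal.coe_mul, div_mul_cancel₀]
        rintro h
        simp [h] at hδ

/-- The constant in Rosenthal's inequality: `C` is the smoothness constant, and the factor
`2 * (C + 1)` allows to absorb half of the left side. -/
noncomputable def rosenthalConst (σ : ℝ) (C : ℝ≥0) : ℝ≥0 :=
  2 * (C + 1) * ((doobConst σ * (2 * (C + 1))) ^ (σ - 1) + 1)

variable {C : ℝ≥0} {Q : ℕ → ℝ≥0∞}

theorem IsProductSubmartingale.lintegral_rpow_ne_top (hW : IsProductSubmartingale μ W)
    (hW0 : ∫⁻ x, W 0 x ^ σ ∂Measure.infinitePi μ = 0) (hV : ∀ n, Measurable (V n)) (hσ : 1 ≤ σ)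
    (step : ∀ n, ∫⁻ x, W (n + 1) x ^ σ ∂Measure.infinitePi μ ≤
      ∫⁻ x, W n x ^ σ ∂Measure.infinitePi μ +
        C * (∫⁻ x, W n x ^ (σ - 1) * V n x ∂Measure.infinitePi μ + Q n)) {n : ℕ}
    (hQ : ∑ k ∈ Finset.range n, Q k ≠ ∞)
    (hVsum : ∫⁻ x, (∑ k ∈ Finset.range n, V k x) ^ σ ∂Measure.infinitePi μ ≠ ∞) :
    ∫⁻ x, W n x ^ σ ∂Measure.infinitePi μ ≠ ∞ := by
  induction n with
  | zero => simp [hW0]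
  | succ n ih =>
    rw [Finset.sum_range_succ, ENNReal.add_ne_top] at hQ
    have hWn := ih hQ.1 (ne_top_of_le_ne_top hVsum (lintegral_mono fun x => by
      gcongr
      exact n.le_succ))
    refine ne_top_of_le_ne_top (ENNReal.add_ne_top.2 ⟨hWn, ENNReal.mul_ne_top ENNReal.coe_ne_top
      (ENNReal.add_ne_top.2 ⟨?_, hQ.2⟩)⟩) (step n)
    refine ne_top_of_le_ne_top (ENNReal.add_ne_top.2 ⟨ENNReal.mul_ne_top ENNReal.coe_ne_top hWn,
      ENNReal.mul_ne_top ENNReal.coe_ne_top hVsum⟩)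
      (le_trans ?_ (hW.sum_lintegral_rpow_sub_one_mul_le hV hσ one_pos n))
    exact Finset.single_le_sum (f := fun k => ∫⁻ x, W k x ^ (σ - 1) * V k x ∂Measure.infinitePi μ)
      (fun _ _ => zero_le) (Finset.self_mem_range_succ n)

theorem le_two_mul_of_le_half_add {A R : ℝ≥0∞} (hA : A ≠ ∞) (h : A ≤ A / 2 + R) : A ≤ 2 * R := by
  nth_rw 1 [← ENNReal.add_halves A] at h
  have := ENNReal.le_of_add_le_add_left (ENNReal.div_ne_top hA two_ne_zero) h
  rwa [mul_comm, ← ENNReal.div_le_iff two_ne_zero ENNReal.ofNat_ne_top]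

theorem le_mul_sum_range_of_le_add_mul {w d : ℕ → ℝ≥0∞} {c : ℝ≥0∞} (hw0 : w 0 = 0)
    (step : ∀ n, w (n + 1) ≤ w n + c * d n) (n : ℕ) : w n ≤ c * ∑ k ∈ Finset.range n, d k := by
  induction n with
  | zero => simp [hw0]
  | succ n ih =>
    rw [Finset.sum_range_succ, mul_add]
    exact (step n).trans (add_le_add_left ih _)

theorem IsProductSubmartingale.lintegral_rpow_le_rosenthalConst (hW : IsProductSubmartingale μ W)
    (hW0 : ∫⁻ x, W 0 x ^ σ ∂Measure.infinitePi μ = 0) (hV : ∀ n, Measurable (V n)) (hσ : 1 ≤ σ)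
    (step : ∀ n, ∫⁻ x, W (n + 1) x ^ σ ∂Measure.infinitePi μ ≤
      ∫⁻ x, W n x ^ σ ∂Measure.infinitePi μ +
        C * (∫⁻ x, W n x ^ (σ - 1) * V n x ∂Measure.infinitePi μ + Q n)) (n : ℕ) :
    ∫⁻ x, W n x ^ σ ∂Measure.infinitePi μ ≤ rosenthalConst σ C * (∑ k ∈ Finset.range n, Q k +
      ∫⁻ x, (∑ k ∈ Finset.range n, V k x) ^ σ ∂Measure.infinitePi μ) := by
  rcases n with _ | n
  · simp [hW0]
  set A := ∫⁻ x, W (n + 1) x ^ σ ∂Measure.infinitePi μ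
  set Vσ := ∫⁻ x, (∑ k ∈ Finset.range (n + 1), V k x) ^ σ ∂Measure.infinitePi μ
  set Qs := ∑ k ∈ Finset.range (n + 1), Q k
  by_cases hR : Qs + Vσ = ∞
  · simp [hR, rosenthalConst, ENNReal.mul_top]
  have hA : A ≠ ∞ := hW.lintegral_rpow_ne_top hW0 hV hσ step (ENNReal.add_ne_top.1 hR).1
    (ENNReal.add_ne_top.1 hR).2
  have telescoped := le_mul_sum_range_of_le_add_mul
    (w := fun n => ∫⁻ x, W n x ^ σ ∂Measure.infinitePi μ) hW0 step (n + 1)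
  rw [Finset.sum_add_distrib] at telescoped
  set ε : ℝ≥0 := (2 * (C + 1))⁻¹ with hε
  set c : ℝ≥0 := (doobConst σ * (2 * (C + 1))) ^ (σ - 1) with hc
  have cross := hW.sum_lintegral_rpow_sub_one_mul_le hV hσ (ε := ε) (by positivity) n
  rw [div_eq_mul_inv, hε, inv_inv, ← hε, ← hc] at cross
  have absorb : A ≤ A / 2 + (C + 1) * ((c + 1) * (Qs + Vσ)) := by
    calc A ≤ C * ((ε * A + c * Vσ) + Qs) := telescoped.trans (by
          gcongr
          refine cross.trans ?_
          gcongr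
          exact hW.monotone_lintegral_rpow hσ n.le_succ)
      _ ≤ (C + 1) * (ε * A + (c + 1) * (Qs + Vσ)) := by
          rw [add_assoc]
          gcongr
          · exact le_self_add
          · rw [add_mul, one_mul, add_comm Qs]
            gcongr
            · exact le_self_add
            · exact le_add_self
      _ = A / 2 + (C + 1) * ((c + 1) * (Qs + Vσ)) := by
          rw [mul_add, ← mul_assoc, div_eq_mul_inv, mul_comm A]
          congr 2
          rw [← ENNReal.coe_one, ← ENNReal.coe_add, ← ENNReal.coe_mul, hε, mul_inv, mul_left_comm,
            mul_inv_cancel₀ (by positivity), mul_one, ENNReal.coe_inv two_ne_zero,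
            ENNReal.coe_ofNat]
  refine (le_two_mul_of_le_half_add hA absorb).trans_eq ?_
  rw [rosenthalConst, ← hc]
  push_cast
  ring

end Submartingale

section Martingale

variable {S : ℕ → Type*} [∀ n, MeasurableSpace (S n)] {Y : Type*} [MeasurableSpace Y]
  {B : Type w} [NormedAddCommGroup B] [NormedSpace ℝ B] [MeasurableSpace B]

/-- Martingale differences on a product space, whose values are functions on `Y`: the `n`-th one,
`D n x t`, depends on the coordinates of `x` before the `n`-th and on the value `t` of the `n`-th
coordinate, and is centered in `t`. -/
structure IsMartingaleDifference (μ : ∀ n, Measure (S n))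
    (D : ∀ n, (∀ k, S k) → S n → Y → B) : Prop where
  measurable : ∀ n, Measurable fun z : (∀ k, S k) × S n × Y => D n z.1 z.2.1 z.2.2
  dependsOn : ∀ n, DependsOn (D n) (Set.Iio n)
  isCentered : ∀ n x, IsCentered (μ n) (D n x)

/-- The martingale with differences `D`. -/
def martingaleSum (D : ∀ n, (∀ k, S k) → S n → Y → B) (n : ℕ) (x : ∀ k, S k) : Y → B :=
  ∑ k ∈ Finset.range n, D k x (x k)

namespace IsMartingaleDifference

variable {μ : ∀ n, Measure (S n)} {D : ∀ n, (∀ k, S k) → S n → Y → B}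

theorem dependsOn_martingaleSum (hD : IsMartingaleDifference μ D) (n : ℕ) :
    DependsOn (martingaleSum D n) (Set.Iio n) := by
  intro x y hxy
  refine Finset.sum_congr rfl fun k hk => ?_
  have hk : k < n := Finset.mem_range.1 hk
  rw [hD.dependsOn k fun i hi => hxy i (lt_trans hi hk), hxy k hk]

theorem martingaleSum_succ_update (hD : IsMartingaleDifference μ D) (n : ℕ) (x : ∀ k, S k)
    (t : S n) :
    martingaleSum D (n + 1) (Function.update x n t) = martingaleSum D n x + D n x t := by
  rw [martingaleSum, Finset.sum_range_succ, Function.update_self,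
    update_eq_of_dependsOn (hD.dependsOn n) Set.self_notMem_Iio]
  exact congrArg (· + D n x t)
    (update_eq_of_dependsOn (hD.dependsOn_martingaleSum n) Set.self_notMem_Iio x t)

variable [BorelSpace B] [SecondCountableTopology B]

theorem measurable_martingaleSum (hD : IsMartingaleDifference μ D) (n : ℕ) :
    Measurable (Function.uncurry (martingaleSum D n)) := by
  have (k : ℕ) : Measurable fun z : (∀ k, S k) × Y => D k z.1 (z.1 k) z.2 :=
    (hD.measurable k).comp (measurable_fst.prodMk
      (((measurable_pi_apply k).comp measurable_fst).prodMk measurable_snd))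
  simpa only [Function.uncurry_def, martingaleSum, Finset.sum_apply]
    using Finset.measurable_sum _ fun k _ => this k

variable {nu : Seminorm ℝ B} {p : ℝ} {ν : Measure Y} [SFinite ν]

omit [SecondCountableTopology B] in
theorem measurable_lpPow (hD : IsMartingaleDifference μ D) (hnu : Continuous nu) (n : ℕ) :
    Measurable fun z : (∀ k, S k) × S n => lpPow nu p ν (D n z.1 z.2) :=
  _root_.measurable_lpPow (D := fun z : (∀ k, S k) × S n => D n z.1 z.2) hnu
    ((hD.measurable n).comp MeasurableEquiv.prodAssoc.measurable)

variable [CompleteSpace B] [∀ n, IsProbabilityMeasure (μ n)]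

theorem isProductSubmartingale_lpPow (hD : IsMartingaleDifference μ D) (hnu : Continuous nu)
    (hp : 1 ≤ p) : IsProductSubmartingale μ fun n x => lpPow nu p ν (martingaleSum D n x) where
  measurable n := _root_.measurable_lpPow hnu (hD.measurable_martingaleSum n)
  dependsOn n _ _ hxy := congrArg (lpPow nu p ν) (hD.dependsOn_martingaleSum n hxy)
  le_lintegral_update n x := by
    simp only [hD.martingaleSum_succ_update]
    exact (hD.isCentered n x).lpPow_le_lintegral_lpPow_add hnu hp
      (hD.measurable_martingaleSum n).of_uncurry_left

variable {σ : ℝ} {C : ℝ≥0}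

theorem lintegral_rpow_lpPow_martingaleSum_succ_le (hD : IsMartingaleDifference μ D)
    (hnu : Continuous nu) (hp : 1 ≤ p) (hσ : 1 ≤ σ) (hC : IsLpSmooth nu p σ C ν) (n : ℕ) :
    ∫⁻ x, lpPow nu p ν (martingaleSum D (n + 1) x) ^ σ ∂Measure.infinitePi μ ≤
      ∫⁻ x, lpPow nu p ν (martingaleSum D n x) ^ σ ∂Measure.infinitePi μ +
        C * (∫⁻ x, lpPow nu p ν (martingaleSum D n x) ^ (σ - 1) *
            ∫⁻ t, lpPow nu p ν (D n x t) ∂μ n ∂Measure.infinitePi μ +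
          ∫⁻ x, ∫⁻ t, lpPow nu p ν (D n x t) ^ σ ∂μ n ∂Measure.infinitePi μ) := by
  have hW := hD.isProductSubmartingale_lpPow (ν := ν) hnu hp
  have hDn := hD.measurable_lpPow (nu := nu) (p := p) (ν := ν) hnu n
  have hcross : Measurable fun x => lpPow nu p ν (martingaleSum D n x) ^ (σ - 1) *
      ∫⁻ t, lpPow nu p ν (D n x t) ∂μ n :=
    ((hW.measurable n).pow_const _).mul hDn.lintegral_prod_right'
  rw [lintegral_infinitePi_update μ n ((hW.measurable (n + 1)).pow_const σ),
    ← lintegral_add_left hcross, ← lintegral_const_mul' _ _ ENNReal.coe_ne_top,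
    ← lintegral_add_left ((hW.measurable n).pow_const _)]
  refine lintegral_mono fun x => ?_
  simp only [hD.martingaleSum_succ_update]
  exact (hD.isCentered n x).lintegral_rpow_lpPow_add_le hnu hp hσ hC
    (hD.measurable_martingaleSum n).of_uncurry_left

theorem rosenthal (hD : IsMartingaleDifference μ D) (hnu : Continuous nu) (hp : 1 ≤ p)
    (hσ : 1 ≤ σ) (hC : IsLpSmooth nu p σ C ν) (n : ℕ) :
    ∫⁻ x, lpPow nu p ν (martingaleSum D n x) ^ σ ∂Measure.infinitePi μ ≤
      rosenthalConst σ C *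
        (∑ k ∈ Finset.range n, ∫⁻ x, ∫⁻ t, lpPow nu p ν (D k x t) ^ σ ∂μ k ∂Measure.infinitePi μ +
          ∫⁻ x, (∑ k ∈ Finset.range n, ∫⁻ t, lpPow nu p ν (D k x t) ∂μ k) ^ σ
            ∂Measure.infinitePi μ) := by
  refine (hD.isProductSubmartingale_lpPow hnu hp).lintegral_rpow_le_rosenthalConst ?_
    (fun k => (hD.measurable_lpPow hnu k).lintegral_prod_right') hσ
    (hD.lintegral_rpow_lpPow_martingaleSum_succ_le hnu hp hσ hC) n
  simp [martingaleSum, lpPow, seminormPow_zero (zero_lt_one.trans_le hp), zero_lt_one.trans_le hσ]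

end IsMartingaleDifference

end Martingale

end Rosenthal

section UpdateFinset

variable {ι : Type*} [DecidableEq ι] {T : ι → Type*} {s : Finset ι} {a : ι}

theorem updateFinset_insert (z g : ∀ l, T l) :
    Function.updateFinset z (insert a s) (fun l => g l) =
      Function.updateFinset (Function.update z a (g a)) s fun l => g l := by
  ext1 l
  by_cases hl : l ∈ s
  · simp [Function.updateFinset, hl]
  · rcases eq_or_ne l a with rfl | hla <;> simp [Function.updateFinset, *]

theorem updateFinset_update (ha : a ∉ s) (z : ∀ l, T l) (t : T a) (y : ∀ l : s, T l) :
    Function.updateFinset (Function.update z a t) s y =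
      Function.update (Function.updateFinset z s y) a t := by
  ext1 l
  rcases eq_or_ne l a with rfl | hl
  · simp [Function.updateFinset, ha]
  · simp [Function.updateFinset, hl]

theorem updateFinset_mem_iff {E : Set (∀ l, T l)} (hE : DependsOn (· ∈ E) (sᶜ : Set ι))
    (x : ∀ l, T l) (y : ∀ l : s, T l) : Function.updateFinset x s y ∈ E ↔ x ∈ E :=
  (hE fun l hl => by simp_all [Function.updateFinset]).to_iff

end UpdateFinset

section Marginals

variable {ι : Type*} [DecidableEq ι] {X : ι → Type*} [∀ l, MeasurableSpace (X l)]
  {μ : ∀ l, Measure (X l)} {s : Finset ι} {f : (∀ l, X l) → ℝ≥0∞}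

theorem dependsOn_lmarginal (f : (∀ l, X l) → ℝ≥0∞) :
    DependsOn (∫⋯∫⁻_s, f ∂μ) (sᶜ : Set ι) := fun _ _ hxy =>
  lmarginal_congr _ _ fun l hl => hxy l hl

theorem lmarginal_indicator {E : Set (∀ l, X l)} (hE : DependsOn (· ∈ E) (sᶜ : Set ι)) :
    ∫⋯∫⁻_s, E.indicator f ∂μ = E.indicator (∫⋯∫⁻_s, f ∂μ) := by
  ext x
  by_cases hx : x ∈ E <;> simp [lmarginal, Set.indicator, updateFinset_mem_iff hE, hx]

theorem lmarginal_of_dependsOn [∀ l, IsProbabilityMeasure (μ l)] (hf : DependsOn f (sᶜ : Set ι)) :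
    ∫⋯∫⁻_s, f ∂μ = f := by
  ext x
  have (y : ∀ l : s, X l) : f (Function.updateFinset x s y) = f x :=
    hf fun l hl => by simp_all [Function.updateFinset]
  simp [lmarginal, this]

variable [Fintype ι] [∀ l, IsProbabilityMeasure (μ l)]

theorem lintegral_lmarginal (hf : Measurable f) :
    ∫⁻ x, (∫⋯∫⁻_s, f ∂μ) x ∂Measure.pi μ = ∫⁻ x, f x ∂Measure.pi μ :=
  lintegral_eq_of_lmarginal_eq s (hf.lmarginal μ) hf
    (lmarginal_of_dependsOn (dependsOn_lmarginal f))

theorem lmarginal_eq_lintegral_of_dependsOn (hf : Measurable f) (hdep : DependsOn f s)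
    (x : ∀ l, X l) : (∫⋯∫⁻_s, f ∂μ) x = ∫⁻ y, f y ∂Measure.pi μ := by
  rw [lintegral_eq_lmarginal_univ x, ← Finset.union_compl s,
    lmarginal_union _ f hf disjoint_compl_right, lmarginal_of_dependsOn (s := sᶜ) (by simpa)]

end Marginals

section MixedIntegrals

variable {ι : Type*} [DecidableEq ι] {T : Type*} [MeasurableSpace T] {I J : Finset ι}
  {lam : Measure T} {σ : ℝ} {F : (ι → T) → ℝ≥0∞}

/-- The mixed integral of `F` with exponent `σ`: the power of the integral over the positions of
`I` is integrated over the positions of `J`. -/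
noncomputable def mixedIntegral (lam : Measure T) (σ : ℝ) (J I : Finset ι) (F : (ι → T) → ℝ≥0∞) :
    (ι → T) → ℝ≥0∞ :=
  ∫⋯∫⁻_J, (fun z => (∫⋯∫⁻_I, F ∂fun _ => lam) z ^ σ) ∂fun _ => lam

theorem mixedIntegral_le_mul (hσ : 0 ≤ σ) {A : ℝ≥0} {G : (ι → T) → ℝ≥0∞}
    (hFG : ∀ z, F z ≤ A * G z) (z : ι → T) :
    mixedIntegral lam σ J I F z ≤ (A ^ σ : ℝ≥0) * mixedIntegral lam σ J I G z := by
  simp only [mixedIntegral, lmarginal]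
  rw [← lintegral_const_mul' _ _ ENNReal.coe_ne_top]
  refine lintegral_mono fun y => ?_
  rw [ENNReal.coe_rpow_of_nonneg _ hσ, ← ENNReal.mul_rpow_of_nonneg _ _ hσ,
    ← lintegral_const_mul' _ _ ENNReal.coe_ne_top]
  gcongr
  exact hFG _

variable [SigmaFinite lam]

theorem measurable_mixedIntegral (hF : Measurable F) : Measurable (mixedIntegral lam σ J I F) :=
  ((hF.lmarginal _).pow_const _).lmarginal _

theorem mixedIntegral_insert {a : ι} (hF : Measurable F) (ha : a ∉ J) (z : ι → T) :
    mixedIntegral lam σ (insert a J) I F z =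
      ∫⁻ w, mixedIntegral lam σ J I F (Function.update z a w) ∂lam :=
  lmarginal_insert _ ((hF.lmarginal _).pow_const _) ha z

end MixedIntegrals

section PairMeasure

variable {S : Type v} [MeasurableSpace S] {μ : Measure S}

/-- The measure that sums over indices and integrates over values; `pairMeasure μ` integrals turn
sums of expectations into expectations of a single variable. -/
noncomputable abbrev pairMeasure (μ : Measure S) : Measure (ℕ × S) := Measure.count.prod μ

theorem sum_range_lintegral_le_lintegral_pairMeasure [SFinite μ] (N : ℕ) {f : ℕ × S → ℝ≥0∞}
    (hf : Measurable f) :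
    ∑ k ∈ Finset.range N, ∫⁻ t, f (k, t) ∂μ ≤ ∫⁻ w, f w ∂pairMeasure μ := by
  rw [lintegral_prod _ hf.aemeasurable, lintegral_count]
  exact ENNReal.sum_le_tsum _

variable {ι : Type*} [DecidableEq ι]

theorem lmarginal_pairMeasure [SigmaFinite μ] (s : Finset ι) {F : (ι → ℕ × S) → ℝ≥0∞}
    (hF : Measurable F) (z : ι → ℕ × S) :
    (∫⋯∫⁻_s, F ∂fun _ => pairMeasure μ) z =
      ∑' a : s → ℕ, (∫⋯∫⁻_s, fun x =>
        F fun l => (Function.updateFinset (fun l => (z l).1) s a l, x l) ∂fun _ => μ)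
          fun l => (z l).2 := by
  have hmp := (measurePreserving_arrowProdEquivProdArrow ℕ S s (fun _ => Measure.count)
    (fun _ => μ)).symm
  have hFm : Measurable fun y : s → ℕ × S => F (Function.updateFinset z s y) :=
    hF.comp measurable_updateFinset
  rw [lmarginal, ← hmp.lintegral_comp hFm]
  refine (lintegral_prod _ (hFm.comp hmp.measurable).aemeasurable).trans ?_
  rw [lintegral_countable']
  refine tsum_congr fun a => ?_
  rw [Measure.pi_singleton]
  simp only [Measure.count_singleton, Finset.prod_const_one, mul_one, lmarginal]
  refine lintegral_congr fun x => congrArg F (funext fun l => ?_)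
  by_cases hl : l ∈ s <;> simp [Function.updateFinset, hl, MeasurableEquiv.arrowProdEquivProdArrow,
    Equiv.arrowProdEquivProdArrow]

end PairMeasure

section MixedMoments

variable {ι : Type*} [Fintype ι] [DecidableEq ι] {S : Type v} [MeasurableSpace S] {μ : Measure S}
  {σ : ℝ} {I : Finset (ι → ℕ)} {φ : (ι → ℕ) → (ι → S) → ℝ≥0∞} {J : Finset ι}

/-- The mixed moments of a family `φ`: sums over the indices in the positions of `J` of the
`σ`-th moments of the sums of the partial integrals over the values in the other positions. -/
noncomputable def mixedMoment (μ : Measure S) (σ : ℝ) (I : Finset (ι → ℕ))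
    (φ : (ι → ℕ) → (ι → S) → ℝ≥0∞) (J : Finset ι) : ℝ≥0∞ :=
  ∑' a : J → ℕ, ∫⁻ x, (∑ i ∈ I with ∀ j : J, i j = a j,
    (∫⋯∫⁻_Jᶜ, φ i ∂fun _ => μ) x) ^ σ ∂Measure.pi fun _ => μ

theorem lmarginal_pairMeasure_eq_sum [SigmaFinite μ] {G : (ι → ℕ × S) → ℝ≥0∞} (hG : Measurable G)
    (hGφ : ∀ i ∈ I, ∀ x : ι → S, G (fun l => (i l, x l)) = φ i x)
    (hG0 : ∀ i ∉ I, ∀ x : ι → S, G (fun l => (i l, x l)) = 0) (i₀ : ι → ℕ) (x : ι → S) :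
    (∫⋯∫⁻_Jᶜ, G ∂fun _ => pairMeasure μ) (fun l => (i₀ l, x l)) =
      ∑ i ∈ I with ∀ j : J, i j = i₀ j, (∫⋯∫⁻_Jᶜ, φ i ∂fun _ => μ) x := by
  have inj : Function.Injective fun b : (Jᶜ : Finset ι) → ℕ => Function.updateFinset i₀ Jᶜ b := by
    intro b b' hbb
    ext l
    simpa [Function.updateFinset, Finset.mem_compl.1 l.2] using congrFun hbb l
  have agree (b : (Jᶜ : Finset ι) → ℕ) : ∀ j ∈ J, Function.updateFinset i₀ Jᶜ b j = i₀ j := by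
    simp +contextual [Function.updateFinset]
  have range (i : ι → ℕ) (hi : ∀ j : J, i j = i₀ j) :
      Function.updateFinset i₀ Jᶜ (fun l => i l) = i := by
    ext l
    by_cases hl : l ∈ J <;> simp [Function.updateFinset, hl, hi ⟨l, _⟩]
  let V (i : ι → ℕ) : ℝ≥0∞ :=
    if i ∈ I.filter (fun i => ∀ j : J, i j = i₀ j) then (∫⋯∫⁻_Jᶜ, φ i ∂fun _ => μ) x else 0
  calc (∫⋯∫⁻_Jᶜ, G ∂fun _ => pairMeasure μ) (fun l => (i₀ l, x l))
      = ∑' b : (Jᶜ : Finset ι) → ℕ, V (Function.updateFinset i₀ Jᶜ b) := by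
        rw [lmarginal_pairMeasure Jᶜ hG]
        refine tsum_congr fun b => ?_
        by_cases hb : Function.updateFinset i₀ Jᶜ b ∈ I
        · simp +contextual [V, hb, agree, hGφ _ hb]
        · simp [V, hb, hG0 _ hb, lmarginal]
    _ = ∑' i, V i := inj.tsum_eq fun i hi =>
        ⟨_, range i (Finset.mem_filter.1 (ite_ne_right_iff.1 hi).1).2⟩
    _ = ∑ i ∈ I with ∀ j : J, i j = i₀ j, V i := tsum_eq_sum fun i hi => if_neg hi
    _ = _ := Finset.sum_congr rfl fun i hi => if_pos hi

theorem mixedIntegral_pairMeasure [IsProbabilityMeasure μ] (hφ : ∀ i ∈ I, Measurable (φ i))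
    {G : (ι → ℕ × S) → ℝ≥0∞} (hG : Measurable G)
    (hGφ : ∀ i ∈ I, ∀ x : ι → S, G (fun l => (i l, x l)) = φ i x)
    (hG0 : ∀ i ∉ I, ∀ x : ι → S, G (fun l => (i l, x l)) = 0) (z : ι → ℕ × S) :
    mixedIntegral (pairMeasure μ) σ J Jᶜ G z = mixedMoment μ σ I φ J := by
  rw [mixedIntegral, lmarginal_pairMeasure J ((hG.lmarginal _).pow_const _), mixedMoment]
  refine tsum_congr fun a => ?_
  simp only [lmarginal_pairMeasure_eq_sum hG hGφ hG0]
  have hval (j : J) : Function.updateFinset (fun l => (z l).1) J a j = a j := by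
    simp [Function.updateFinset]
  simp only [hval]
  refine lmarginal_eq_lintegral_of_dependsOn ((Finset.measurable_sum _ fun i hi =>
    (hφ i (Finset.mem_filter.1 hi).1).lmarginal _).pow_const _) (fun x y hxy => ?_) _
  exact congrArg (· ^ σ) (Finset.sum_congr rfl fun i _ => dependsOn_lmarginal _ (by simpa))

theorem mixedMoment_univ (hσ : 0 < σ) :
    mixedMoment μ σ I φ Finset.univ = ∑ i ∈ I, ∫⁻ x, φ i x ^ σ ∂Measure.pi fun _ => μ := by
  let e : (↥(Finset.univ : Finset ι) → ℕ) ≃ (ι → ℕ) :=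
    (Equiv.subtypeUnivEquiv Finset.mem_univ).arrowCongr (Equiv.refl ℕ)
  have agree (i : ι → ℕ) (a : ↥(Finset.univ : Finset ι) → ℕ) :
      (∀ j : ↥(Finset.univ : Finset ι), i j = a j) ↔ i = e a := by
    rw [← e.symm.injective.eq_iff, e.symm_apply_apply, funext_iff]
    rfl
  simp only [mixedMoment, agree, Finset.filter_eq', Finset.compl_univ, lmarginal_empty]
  rw [e.tsum_eq fun a => ∫⁻ x, (∑ i ∈ if a ∈ I then {a} else ∅, φ i x) ^ σ ∂_,
    tsum_eq_sum (s := I) fun a ha => by simp [ha, hσ]]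
  exact Finset.sum_congr rfl fun a ha => by simp [ha]

theorem mixedMoment_empty [IsProbabilityMeasure μ] :
    mixedMoment μ σ I φ ∅ = (∑ i ∈ I, ∫⁻ x, φ i x ∂Measure.pi fun _ => μ) ^ σ := by
  simp [mixedMoment, lmarginal_univ]

theorem mixedMoment_one [IsProbabilityMeasure μ] (hφ : ∀ i ∈ I, Measurable (φ i)) :
    mixedMoment μ 1 I φ J = ∑ i ∈ I, ∫⁻ x, φ i x ∂Measure.pi fun _ => μ := by
  have agree (i : ι → ℕ) (a : J → ℕ) : (∀ j : J, i j = a j) ↔ a = J.restrict i := by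
    simp [funext_iff, eq_comm]
  calc mixedMoment μ 1 I φ J
      = ∑' a : J → ℕ, ∑ i ∈ I, if a = J.restrict i then ∫⁻ x, φ i x ∂Measure.pi fun _ => μ
          else 0 := by
        refine tsum_congr fun a => ?_
        simp only [ENNReal.rpow_one]
        rw [lintegral_finsetSum' _ fun i hi =>
          ((hφ i (Finset.mem_filter.1 hi).1).lmarginal _).aemeasurable, Finset.sum_filter]
        refine Finset.sum_congr rfl fun i hi => ?_
        simp only [agree, lintegral_lmarginal (hφ i hi)]
    _ = ∑ i ∈ I, ∫⁻ x, φ i x ∂Measure.pi fun _ => μ := by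
        rw [Summable.tsum_finsetSum fun i _ => ENNReal.summable]
        exact Finset.sum_congr rfl fun i _ => tsum_ite_eq _ _

end MixedMoments

section PartialSums

variable {S : Type v} {B : Type w} [NormedAddCommGroup B] {ι : Type*} [LinearOrder ι]

/-- The kernel `h`, a function of index-value pairs `z l = (i l, x (i l))`, summed over the pairs
`(k, x k)`, `k < N`, in each of the positions of `s`. -/
def partialSum (N : ℕ) (h : (ι → ℕ × S) → B) (s : Finset ι) (x : ℕ → S) (z : ι → ℕ × S) : B :=
  ∑ i ∈ Fintype.piFinset fun _ : s => Finset.range N,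
    h (Function.updateFinset z s fun l => (i l, x (i l)))

variable {N : ℕ} {h : (ι → ℕ × S) → B} {s : Finset ι}

theorem partialSum_empty (x : ℕ → S) (z : ι → ℕ × S) : partialSum N h ∅ x z = h z := by
  simp [partialSum]

theorem partialSum_insert {a : ι} (ha : a ∉ s) (x : ℕ → S) (z : ι → ℕ × S) :
    partialSum N h (insert a s) x z =
      ∑ k ∈ Finset.range N, partialSum N h s x (Function.update z a (k, x k)) := by
  simp only [partialSum, ← Finset.sum_product']
  let extend (k : ℕ) (i : s → ℕ) (l : ι) : ℕ := if hl : l ∈ s then i ⟨l, hl⟩ else k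
  have extend_self (k : ℕ) (i : s → ℕ) : extend k i a = k := dif_neg ha
  have extend_coe (k : ℕ) (i : s → ℕ) (l : s) : extend k i l = i l := dif_pos l.2
  refine (Finset.sum_nbij' (fun ki (l : ↥(insert a s)) => extend ki.1 ki.2 l)
    (fun i : ↥(insert a s) → ℕ =>
      (i ⟨a, Finset.mem_insert_self a s⟩, fun l : s => i ⟨l, Finset.mem_insert_of_mem l.2⟩))
    ?_ ?_ ?_ ?_ ?_).symm
  · rintro ⟨k, i⟩ hki
    simp only [Finset.mem_product, Fintype.mem_piFinset] at hki ⊢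
    intro l
    simp only [extend]
    split_ifs
    exacts [hki.2 _, hki.1]
  · intro i hi
    simp only [Finset.mem_product, Fintype.mem_piFinset] at hi ⊢
    exact ⟨hi _, fun l => hi _⟩
  · rintro ⟨k, i⟩ -
    simp [extend_self, extend_coe]
  · intro i _
    ext ⟨l, hl⟩
    rcases Finset.mem_insert.1 hl with rfl | hls
    · exact extend_self _ _
    · exact extend_coe _ _ ⟨l, hls⟩
  · rintro ⟨k, i⟩ -
    have := updateFinset_insert (s := s) (a := a) z
      fun l => (extend k i l, x (extend k i l))
    simp only [extend_self, extend_coe] at this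
    rw [this]

theorem dependsOn_partialSum (hh : ∀ z, ¬StrictMono (fun l => (z l).1) → h z = 0) {a : ι}
    (ha : ∀ l ∈ s, l < a) (z : ι → ℕ × S) :
    DependsOn (fun x => partialSum N h s x z) (Set.Iio (z a).1) := by
  intro x y hxy
  refine Finset.sum_congr rfl fun i _ => ?_
  by_cases hi : ∀ l, i l < (z a).1
  · simp only [hxy _ (hi _)]
  obtain ⟨l, hl⟩ := not_forall.1 hi
  have vanish (x : ℕ → S) : h (Function.updateFinset z s fun l => (i l, x (i l))) = 0 := by
    refine hh _ fun hmono => hl ?_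
    simpa [Function.updateFinset, show a ∉ s from fun has => lt_irrefl a (ha a has)]
      using hmono (ha l l.2)
  rw [vanish, vanish]

variable [MeasurableSpace S]

theorem measurable_partialSum [MeasurableSpace B] [BorelSpace B] [SecondCountableTopology B]
    (hh : Measurable h) :
    Measurable (Function.uncurry (partialSum N h s)) := by
  have (i : s → ℕ) : Measurable fun w : (ℕ → S) × (ι → ℕ × S) => fun l => (i l, w.1 (i l)) :=
    measurable_pi_lambda _ fun l =>
      measurable_const.prodMk ((measurable_pi_apply (i l)).comp measurable_fst)
  exact Finset.measurable_sum _ fun i _ =>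
    hh.comp (measurable_updateFinset'.comp (measurable_snd.prodMk (this i)))

variable [NormedSpace ℝ B]

/-- The `p`-th power of the `L^p` norm of `partialSum N h s x` as a function of its arguments in the
positions of `I`. -/
noncomputable def partialLpPow (nu : Seminorm ℝ B) (p : ℝ) (μ : Measure S) (N : ℕ)
    (h : (ι → ℕ × S) → B) (s I : Finset ι) (x : ℕ → S) (z : ι → ℕ × S) : ℝ≥0∞ :=
  (∫⋯∫⁻_I, fun z => seminormPow nu p (partialSum N h s x z) ∂fun _ => pairMeasure μ) z

variable {nu : Seminorm ℝ B} {p : ℝ} {μ : Measure S} {a : ι} {I : Finset ι}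

theorem lpPow_martingaleSum_partialSum (ha : a ∉ s) (x : ℕ → S) (z : ι → ℕ × S) :
    lpPow nu p (Measure.pi fun _ : I => pairMeasure μ)
        (martingaleSum (fun k x t (y : I → ℕ × S) => partialSum N h s x
          (Function.update (Function.updateFinset z I y) a (k, t))) N x) =
      partialLpPow nu p μ N h (insert a s) I x z := by
  simp only [partialLpPow, lmarginal, lpPow, partialSum_insert ha, martingaleSum, Finset.sum_apply]

theorem lpPow_partialSum_update (ha : a ∉ I) (x : ℕ → S) (z : ι → ℕ × S) (w : ℕ × S) :
    lpPow nu p (Measure.pi fun _ : I => pairMeasure μ)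
        (fun y => partialSum N h s x (Function.update (Function.updateFinset z I y) a w)) =
      partialLpPow nu p μ N h s I x (Function.update z a w) := by
  simp only [partialLpPow, lmarginal, lpPow, updateFinset_update ha]

variable [MeasurableSpace B]

/-- A kernel of index-value pairs that vanishes off the strictly increasing tuples of indices and
is centered in each of its arguments. -/
structure IsCenteredKernel (μ : Measure S) (h : (ι → ℕ × S) → B) : Prop where
  measurable : Measurable h
  eq_zero : ∀ z, ¬StrictMono (fun l => (z l).1) → h z = 0
  integrable : ∀ z l k, Integrable (fun t => h (Function.update z l (k, t))) μ
  integral_eq_zero : ∀ z l k, ∫ t, h (Function.update z l (k, t)) ∂μ = 0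

namespace IsCenteredKernel

theorem integrable_partialSum (hh : IsCenteredKernel μ h) (ha : a ∉ s) (x : ℕ → S)
    (z : ι → ℕ × S) (k : ℕ) :
    Integrable (fun t => partialSum N h s x (Function.update z a (k, t))) μ := by
  simp only [partialSum, updateFinset_update ha]
  exact integrable_finsetSum _ fun i _ => hh.integrable _ a k

theorem integral_partialSum_eq_zero (hh : IsCenteredKernel μ h) (ha : a ∉ s) (x : ℕ → S)
    (z : ι → ℕ × S) (k : ℕ) :
    ∫ t, partialSum N h s x (Function.update z a (k, t)) ∂μ = 0 := by
  simp only [partialSum, updateFinset_update ha]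
  rw [integral_finsetSum _ fun i _ => hh.integrable _ a k]
  exact Finset.sum_eq_zero fun i _ => hh.integral_eq_zero _ a k

theorem isMartingaleDifference [BorelSpace B] [SecondCountableTopology B]
    (hh : IsCenteredKernel μ h) (ha : ∀ l ∈ s, l < a) (I : Finset ι) (z : ι → ℕ × S) :
    IsMartingaleDifference (fun _ => μ) fun k x t (y : I → ℕ × S) =>
      partialSum N h s x (Function.update (Function.updateFinset z I y) a (k, t)) where
  measurable k := by
    refine (measurable_partialSum hh.measurable).comp (measurable_fst.prodMk ?_)
    exact (measurable_update_prodMk a).comp ((measurable_updateFinset.comp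
      (measurable_snd.comp measurable_snd)).prodMk
      (measurable_const.prodMk (measurable_fst.comp measurable_snd)))
  dependsOn k x x' hx := by
    ext t y
    refine dependsOn_partialSum hh.eq_zero ha _ ?_
    simpa using hx
  isCentered k x := by
    have has : a ∉ s := fun h => lt_irrefl a (ha a h)
    refine ⟨?_, fun y => hh.integrable_partialSum has x _ k,
      fun y => hh.integral_partialSum_eq_zero has x _ k⟩
    refine (measurable_partialSum hh.measurable).comp (measurable_const.prodMk ?_)
    exact (measurable_update_prodMk a).comp ((measurable_updateFinset.comp
      measurable_snd).prodMk (measurable_const.prodMk measurable_fst))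

end IsCenteredKernel

section Measurability

variable [BorelSpace B] [SecondCountableTopology B]

theorem measurable_seminormPow_partialSum (hnu : Continuous nu) (hh : Measurable h) :
    Measurable (Function.uncurry fun x z => seminormPow nu p (partialSum N h s x z)) :=
  (measurable_seminormPow hnu).comp (measurable_partialSum hh)

variable [SigmaFinite μ]

theorem measurable_partialLpPow (hnu : Continuous nu) (hh : Measurable h) :
    Measurable (Function.uncurry (partialLpPow nu p μ N h s I)) := by
  have update : Measurable fun w : ((ℕ → S) × (ι → ℕ × S)) × (I → ℕ × S) =>
      (w.1.1, Function.updateFinset w.1.2 I w.2) :=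
    (measurable_fst.comp measurable_fst).prodMk
      (measurable_updateFinset'.comp ((measurable_snd.comp measurable_fst).prodMk measurable_snd))
  exact ((measurable_seminormPow_partialSum hnu hh).comp update).lintegral_prod_right'

theorem measurable_prodMk_update (a : ι) (z : ι → ℕ × S) :
    Measurable fun w : (ℕ → S) × (ℕ × S) => (w.1, Function.update z a w.2) :=
  measurable_fst.prodMk ((measurable_update z).comp measurable_snd)

theorem measurable_partialLpPow_update (hnu : Continuous nu) (hh : Measurable h) (a : ι)
    (z : ι → ℕ × S) : Measurable fun w : (ℕ → S) × (ℕ × S) =>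
      partialLpPow nu p μ N h s I w.1 (Function.update z a w.2) := by
  have h := (measurable_partialLpPow (p := p) (μ := μ) (N := N) (s := s) (I := I) hnu hh).comp
    (measurable_prodMk_update a z)
  exact h

theorem partialLpPow_insert_right (hnu : Continuous nu) (hh : Measurable h) (ha : a ∉ I)
    (x : ℕ → S) (z : ι → ℕ × S) :
    partialLpPow nu p μ N h s (insert a I) x z =
      ∫⁻ w, partialLpPow nu p μ N h s I x (Function.update z a w) ∂pairMeasure μ :=
  lmarginal_insert _ (measurable_seminormPow_partialSum hnu hh).of_uncurry_left ha z

end Measurability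

variable [BorelSpace B] [SecondCountableTopology B] [CompleteSpace B] [IsProbabilityMeasure μ]
  {σ : ℝ} {C : ℝ≥0}

theorem IsCenteredKernel.lintegral_rpow_partialLpPow_insert_le (hh : IsCenteredKernel μ h)
    (hnu : Continuous nu) (hp : 1 ≤ p) (hσ : 1 ≤ σ)
    (hC : IsLpSmooth nu p σ C (Measure.pi fun _ : I => pairMeasure μ))
    (ha : ∀ l ∈ s, l < a) (haI : a ∉ I) (z : ι → ℕ × S) :
    ∫⁻ x, partialLpPow nu p μ N h (insert a s) I x z ^ σ ∂Measure.infinitePi (fun _ => μ) ≤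
      rosenthalConst σ C *
        (∫⁻ w, ∫⁻ x, partialLpPow nu p μ N h s I x (Function.update z a w) ^ σ
            ∂Measure.infinitePi (fun _ => μ) ∂pairMeasure μ +
          ∫⁻ x, partialLpPow nu p μ N h s (insert a I) x z ^ σ
            ∂Measure.infinitePi (fun _ => μ)) := by
  have has : a ∉ s := fun h => lt_irrefl a (ha a h)
  have hm := measurable_partialLpPow_update (p := p) (μ := μ) (N := N) (s := s) (I := I) hnu
    hh.measurable a z
  have rosenthal := (hh.isMartingaleDifference (N := N) ha I z).rosenthal hnu hp hσ hC N
  simp only [lpPow_martingaleSum_partialSum has, lpPow_partialSum_update haI] at rosenthal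
  refine rosenthal.trans (mul_le_mul_right (add_le_add ?_ (lintegral_mono fun x => ?_)) _)
  · simp only [lintegral_lintegral_swap (f := fun x t =>
      partialLpPow nu p μ N h s I x (Function.update z a (_, t)) ^ σ)
      ((hm.comp (measurable_fst.prodMk (measurable_const.prodMk measurable_snd))).pow_const
        σ).aemeasurable]
    exact sum_range_lintegral_le_lintegral_pairMeasure N (hm.pow_const σ).lintegral_prod_left'
  · rw [partialLpPow_insert_right hnu hh.measurable haI]
    gcongr
    have hmx := hm.comp (measurable_prodMk_left (x := x))
    exact sum_range_lintegral_le_lintegral_pairMeasure N hmx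

theorem IsCenteredKernel.lintegral_rpow_partialLpPow_le (hh : IsCenteredKernel μ h)
    (hnu : Continuous nu) (hp : 1 ≤ p) (hσ : 1 ≤ σ)
    (hC : ∀ I : Finset ι, IsLpSmooth nu p σ C (Measure.pi fun _ : I => pairMeasure μ))
    (s : Finset ι) (I : Finset ι) (hsI : Disjoint s I) (z : ι → ℕ × S) :
    ∫⁻ x, partialLpPow nu p μ N h s I x z ^ σ ∂Measure.infinitePi (fun _ => μ) ≤
      rosenthalConst σ C ^ s.card * ∑ J ∈ s.powerset,
        mixedIntegral (pairMeasure μ) σ J (s \ J ∪ I) (fun z => seminormPow nu p (h z)) z := by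
  have hF : Measurable fun z => seminormPow nu p (h z) :=
    (measurable_seminormPow hnu).comp hh.measurable
  induction s using Finset.induction_on_max generalizing I z with
  | empty => simp [partialLpPow, partialSum_empty, mixedIntegral]
  | insert a s ha ih =>
    have has : a ∉ s := fun h => lt_irrefl a (ha a h)
    obtain ⟨haI, hsI⟩ := Finset.disjoint_insert_left.1 hsI
    refine (hh.lintegral_rpow_partialLpPow_insert_le hnu hp hσ (hC I) ha haI z).trans ?_
    rw [Finset.card_insert_of_notMem has, pow_succ', mul_assoc, Finset.sum_powerset_insert has]
    gcongr
    rw [add_comm, mul_add]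
    gcongr ?_ + ?_
    · refine (ih (insert a I) (Finset.disjoint_insert_right.2 ⟨has, hsI⟩) z).trans_eq ?_
      congr 1
      refine Finset.sum_congr rfl fun J hJ => ?_
      rw [Finset.insert_sdiff_of_notMem _ fun h => has (Finset.mem_powerset.1 hJ h),
        Finset.union_insert, Finset.insert_union]
    · have hmixed (J : Finset ι) : Measurable fun w => mixedIntegral (pairMeasure μ) σ J
          (s \ J ∪ I) (fun z => seminormPow nu p (h z)) (Function.update z a w) :=
        (measurable_mixedIntegral hF).comp (measurable_update z)
      refine (lintegral_mono fun w => ih I hsI _).trans_eq ?_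
      rw [lintegral_const_mul' _ _ (by finiteness), lintegral_finsetSum _ fun J _ => hmixed J]
      congr 1
      refine Finset.sum_congr rfl fun J hJ => ?_
      rw [mixedIntegral_insert hF fun h => has (Finset.mem_powerset.1 hJ h),
        Finset.insert_sdiff_insert, Finset.sdiff_insert_of_notMem has]

end PartialSums

section CoordinateVariables

variable {m n N : ℕ} {S : Type v} {B : Type w} [NormedAddCommGroup B]
  {h : (Fin m → ℕ) → (Fin m → S) → B}

theorem mem_Inc {i : Fin m → ℕ} : i ∈ Inc m n ↔ (∀ l, i l < n) ∧ StrictMono i := by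
  classical
  simp [Inc, Fintype.mem_piFinset]

theorem Inc_subset_Inc_succ (m n : ℕ) : Inc m n ⊆ Inc m (n + 1) := fun _ hi =>
  mem_Inc.2 ⟨fun l => ((mem_Inc.1 hi).1 l).trans n.lt_succ_self, (mem_Inc.1 hi).2⟩

theorem exists_eq_of_mem_Inc_succ_sdiff {i : Fin m → ℕ} (hi : i ∈ Inc m (n + 1) \ Inc m n) :
    ∃ l, i l = n := by
  obtain ⟨hlt, hge⟩ := Finset.mem_sdiff.1 hi
  by_contra! hne
  exact hge (mem_Inc.2 ⟨fun l => (Nat.lt_succ_iff.1 ((mem_Inc.1 hlt).1 l)).lt_of_ne (hne l),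
    (mem_Inc.1 hlt).2⟩)

theorem dependsOn_UStat (h : (Fin m → ℕ) → (Fin m → S) → B) (n : ℕ) :
    DependsOn (UStat h Function.eval n) (Set.Iio n) := fun _ _ hxy =>
  Finset.sum_congr rfl fun _ hi => congrArg (h _) (funext fun l => hxy _ ((mem_Inc.1 hi).1 l))

theorem UStat_succ_update (x : ℕ → S) (t : S) :
    UStat h Function.eval (n + 1) (Function.update x n t) =
      ∑ i ∈ Inc m (n + 1) \ Inc m n, h i (Function.update x n t ∘ i) +
        UStat h Function.eval n x := by
  rw [← update_eq_of_dependsOn (dependsOn_UStat h n) (Set.self_notMem_Iio) x t]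
  exact (Finset.sum_sdiff (Inc_subset_Inc_succ m n)).symm

/-- The kernel of `UStat h ξ N` as a function of index-value pairs `z l = (i l, x (i l))`. -/
noncomputable def pairKernel (h : (Fin m → ℕ) → (Fin m → S) → B) (N : ℕ) (z : Fin m → ℕ × S) : B :=
  if (fun l => (z l).1) ∈ Inc m N then h (fun l => (z l).1) fun l => (z l).2 else 0

theorem pairKernel_update (z : Fin m → ℕ × S) (l : Fin m) (k : ℕ) (t : S) :
    pairKernel h N (Function.update z l (k, t)) =
      if Function.update (fun l => (z l).1) l k ∈ Inc m N then
        h (Function.update (fun l => (z l).1) l k) (Function.update (fun l => (z l).2) l t)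
      else 0 := by
  have fst_update : (fun j => (Function.update z l (k, t) j).1) =
      Function.update (fun l => (z l).1) l k :=
    Function.comp_update Prod.fst z l (k, t)
  have snd_update : (fun j => (Function.update z l (k, t) j).2) =
      Function.update (fun l => (z l).2) l t :=
    Function.comp_update Prod.snd z l (k, t)
  rw [pairKernel, fst_update, snd_update]

theorem partialSum_pairKernel_univ (x : ℕ → S) (z : Fin m → ℕ × S) :
    partialSum N (pairKernel h N) Finset.univ x z = UStat h Function.eval N x := by
  classical
  calc partialSum N (pairKernel h N) Finset.univ x z
      = ∑ i ∈ Fintype.piFinset fun _ : Fin m => Finset.range N,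
          pairKernel h N fun l => (i l, x (i l)) := by
        refine Finset.sum_equiv (Equiv.arrowCongr
          (Equiv.subtypeUnivEquiv Finset.mem_univ) (Equiv.refl ℕ)) (fun i => ?_) fun i _ => ?_
        · simp [Fintype.mem_piFinset]
        · exact congrArg (pairKernel h N) (funext fun l => dif_pos (Finset.mem_univ l))
    _ = UStat h Function.eval N x := by
        simp only [pairKernel, UStat, ← Finset.sum_filter]
        refine Finset.sum_congr ?_ fun _ _ => rfl
        ext i
        simp only [Finset.mem_filter, Fintype.mem_piFinset, Finset.mem_range, mem_Inc]
        tauto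

variable [MeasurableSpace S] [MeasurableSpace B]

theorem measurable_UStat [BorelSpace B] [SecondCountableTopology B]
    (hh : ∀ i, StrictMono i → Measurable (h i)) (n : ℕ) :
    Measurable (UStat h Function.eval n) :=
  Finset.measurable_sum _ fun i hi => (hh i (mem_Inc.1 hi).2).comp
    (measurable_pi_iff.2 fun l => measurable_pi_apply (i l))

theorem measurable_pairKernel (hh : ∀ i, StrictMono i → Measurable (h i)) (N : ℕ) :
    Measurable (pairKernel h N) := by
  have curried : Measurable fun w : (Fin m → S) × (Fin m → ℕ) =>
      if w.2 ∈ Inc m N then h w.2 w.1 else 0 := by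
    refine measurable_from_prod_countable_left fun i => ?_
    by_cases hi : i ∈ Inc m N
    · simpa only [hi, if_true] using hh i (mem_Inc.1 hi).2
    · simp only [hi, if_false, measurable_const]
  have unzip : Measurable fun z : Fin m → ℕ × S => (fun l => (z l).2, fun l => (z l).1) :=
    (measurable_pi_lambda _ fun l => measurable_snd.comp (measurable_pi_apply l)).prodMk
      (measurable_pi_lambda _ fun l => measurable_fst.comp (measurable_pi_apply l))
  exact curried.comp unzip

variable [NormedSpace ℝ B]

/-- Degeneracy of a kernel in the pointwise sense: the integrals over each of its arguments vanish
at every point, rather than almost everywhere. -/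
structure IsPointwiseDegenerate {ι : Type*} [DecidableEq ι] (μ : Measure S) (f : (ι → S) → B) :
    Prop where
  measurable : Measurable f
  integrable : ∀ x l, Integrable (fun t => f (Function.update x l t)) μ
  integral_eq_zero : ∀ x l, ∫ t, f (Function.update x l t) ∂μ = 0

variable {μ : Measure S}

theorem IsPointwiseDegenerate.integrable_update_comp {f : (Fin m → S) → B}
    (hf : IsPointwiseDegenerate μ f) {i : Fin m → ℕ} (hi : Function.Injective i) (l : Fin m)
    (x : ℕ → S) : Integrable (fun t => f (Function.update x (i l) t ∘ i)) μ := by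
  simpa only [Function.update_comp_eq_of_injective _ hi] using hf.integrable (x ∘ i) l

theorem IsPointwiseDegenerate.integral_update_comp {f : (Fin m → S) → B}
    (hf : IsPointwiseDegenerate μ f) {i : Fin m → ℕ} (hi : Function.Injective i) (l : Fin m)
    (x : ℕ → S) : ∫ t, f (Function.update x (i l) t ∘ i) ∂μ = 0 := by
  simpa only [Function.update_comp_eq_of_injective _ hi] using hf.integral_eq_zero (x ∘ i) l

theorem integrable_and_integral_eq_zero_of_mem_Inc_succ_sdiff
    (hh : ∀ i, StrictMono i → IsPointwiseDegenerate μ (h i)) (x : ℕ → S) {i : Fin m → ℕ}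
    (hi : i ∈ Inc m (n + 1) \ Inc m n) :
    Integrable (fun t => h i (Function.update x n t ∘ i)) μ ∧
      ∫ t, h i (Function.update x n t ∘ i) ∂μ = 0 := by
  obtain ⟨l, rfl⟩ := exists_eq_of_mem_Inc_succ_sdiff hi
  have hmono := (mem_Inc.1 (Finset.mem_sdiff.1 hi).1).2
  exact ⟨(hh i hmono).integrable_update_comp hmono.injective l x,
    (hh i hmono).integral_update_comp hmono.injective l x⟩

section Martingale

variable [IsProbabilityMeasure μ]

theorem integrable_UStat_succ_update (hh : ∀ i, StrictMono i → IsPointwiseDegenerate μ (h i))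
    (n : ℕ) (x : ℕ → S) :
    Integrable (fun t => UStat h Function.eval (n + 1) (Function.update x n t)) μ := by
  simp only [UStat_succ_update]
  exact (integrable_finsetSum _ fun i hi =>
    (integrable_and_integral_eq_zero_of_mem_Inc_succ_sdiff hh x hi).1).add (integrable_const _)

theorem integral_UStat_succ_update [CompleteSpace B]
    (hh : ∀ i, StrictMono i → IsPointwiseDegenerate μ (h i)) (n : ℕ) (x : ℕ → S) :
    ∫ t, UStat h Function.eval (n + 1) (Function.update x n t) ∂μ = UStat h Function.eval n x := by
  have new (i) (hi : i ∈ Inc m (n + 1) \ Inc m n) :=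
    integrable_and_integral_eq_zero_of_mem_Inc_succ_sdiff hh x hi
  simp only [UStat_succ_update]
  rw [integral_add (integrable_finsetSum _ fun i hi => (new i hi).1) (integrable_const _),
    integral_finsetSum _ fun i hi => (new i hi).1, Finset.sum_eq_zero fun i hi => (new i hi).2]
  simp

variable [CompleteSpace B] [BorelSpace B] [SecondCountableTopology B] {nu : Seminorm ℝ B}

theorem isProductSubmartingale_seminormPow_UStat
    (hh : ∀ i, StrictMono i → IsPointwiseDegenerate μ (h i)) (hnu : Continuous nu) :
    IsProductSubmartingale (fun _ => μ) fun n x =>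
      seminormPow nu 1 (UStat h Function.eval n x) where
  measurable n := (measurable_seminormPow hnu).comp
    (measurable_UStat (fun i hi => (hh i hi).measurable) n)
  dependsOn n _ _ hxy := congrArg (seminormPow nu 1) (dependsOn_UStat h n hxy)
  le_lintegral_update n x := by
    have := seminormPow_integral_le hnu le_rfl (integrable_UStat_succ_update hh n x)
    rwa [integral_UStat_succ_update hh] at this

theorem maxMoment_eval_le (hh : ∀ i, StrictMono i → IsPointwiseDegenerate μ (h i))
    (hnu : Continuous nu) {p q : ℝ} (hp : 0 < p) (hq : 1 < q) {A : ℝ≥0}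
    (hA : ∀ x, ‖x‖ₑ ^ p ≤ A * seminormPow nu p x) (N : ℕ) :
    maxMoment h Function.eval (Measure.infinitePi fun _ : ℕ => μ) N q ≤
      (A ^ (q / p) * doobConst q : ℝ≥0) *
        ∫⁻ x, seminormPow nu p (UStat h Function.eval N x) ^ (q / p)
          ∂Measure.infinitePi fun _ : ℕ => μ := by
  have hq0 : 0 ≤ q := by linarith
  have hσ : 0 ≤ q / p := div_nonneg hq0 hp.le
  have rpow_eq (y : B) : seminormPow nu p y ^ (q / p) = seminormPow nu 1 y ^ q := by
    simp only [seminormPow, ← ENNReal.rpow_mul, mul_div_cancel₀ _ hp.ne', one_mul]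
  have enorm_le (y : B) : ‖y‖ₑ ^ q ≤ (A ^ (q / p) : ℝ≥0) * seminormPow nu 1 y ^ q := by
    have := ENNReal.rpow_le_rpow (hA y) hσ
    rwa [← ENNReal.rpow_mul, mul_div_cancel₀ _ hp.ne', ENNReal.mul_rpow_of_nonneg _ _ hσ,
      rpow_eq, ← ENNReal.coe_rpow_of_nonneg _ hσ] at this
  set X : ℕ → (ℕ → S) → ℝ≥0∞ := fun n x => seminormPow nu 1 (UStat h Function.eval n x)
  have sup_le (x : ℕ → S) : (Finset.Icc m N).sup (fun n => ‖UStat h Function.eval n x‖ₑ ^ q) ≤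
      (A ^ (q / p) : ℝ≥0) * partialSups X N x ^ q := by
    refine Finset.sup_le fun n hn => (enorm_le _).trans ?_
    gcongr
    exact le_partialSups_of_le X (Finset.mem_Icc.1 hn).2 x
  calc maxMoment h Function.eval (Measure.infinitePi fun _ : ℕ => μ) N q
      ≤ ∫⁻ x, (A ^ (q / p) : ℝ≥0) * partialSups X N x ^ q ∂Measure.infinitePi fun _ => μ :=
        lintegral_mono sup_le
    _ ≤ (A ^ (q / p) : ℝ≥0) *
          (doobConst q * ∫⁻ x, X N x ^ q ∂Measure.infinitePi fun _ => μ) := by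
        rw [lintegral_const_mul' _ _ ENNReal.coe_ne_top]
        gcongr
        exact (isProductSubmartingale_seminormPow_UStat hh hnu).doob hq N
    _ = _ := by simp only [rpow_eq, ENNReal.coe_mul, mul_assoc, X]

end Martingale

theorem isCenteredKernel_pairKernel (hh : ∀ i, StrictMono i → IsPointwiseDegenerate μ (h i))
    (N : ℕ) : IsCenteredKernel μ (pairKernel h N) where
  measurable := measurable_pairKernel (fun i hi => (hh i hi).measurable) N
  eq_zero z hz := if_neg fun hi => hz (mem_Inc.1 hi).2
  integrable z l k := by
    simp only [pairKernel_update]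
    split_ifs with hi
    exacts [(hh _ (mem_Inc.1 hi).2).integrable _ l, integrable_zero _ _ _]
  integral_eq_zero z l k := by
    simp only [pairKernel_update]
    split_ifs with hi
    exacts [(hh _ (mem_Inc.1 hi).2).integral_eq_zero _ l, integral_zero _ _]

variable [BorelSpace B] [IsProbabilityMeasure μ] {nu : Seminorm ℝ B} {p σ : ℝ}

theorem mixedIntegral_pairKernel_le (hh : ∀ i, StrictMono i → Measurable (h i)) (hp : 0 < p)
    (hσ : 0 ≤ σ) {A : ℝ≥0} (hA : ∀ x, seminormPow nu p x ≤ A * ‖x‖ₑ ^ p) (J : Finset (Fin m))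
    (z : Fin m → ℕ × S) :
    mixedIntegral (pairMeasure μ) σ J Jᶜ (fun z => seminormPow nu p (pairKernel h N z)) z ≤
      (A ^ σ : ℝ≥0) * mixedMoment μ σ (Inc m N) (fun i x => ‖h i x‖ₑ ^ p) J := by
  rw [← mixedIntegral_pairMeasure (G := fun z => ‖pairKernel h N z‖ₑ ^ p)
    (fun i hi => (hh i (mem_Inc.1 hi).2).enorm.pow_const p)
    ((measurable_pairKernel hh N).enorm.pow_const p)
    (fun i hi x => by simp only [pairKernel, if_pos hi])
    (fun i hi x => by simp [pairKernel, if_neg hi, hp]) z]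
  exact mixedIntegral_le_mul hσ (fun z => hA _) z

variable [CompleteSpace B] [SecondCountableTopology B]

theorem lintegral_seminormPow_UStat_rpow_le
    (hh : ∀ i, StrictMono i → IsPointwiseDegenerate μ (h i)) (hnu : Continuous nu) (hp : 1 ≤ p)
    (hσ : 1 ≤ σ) {A C : ℝ≥0} (hA : ∀ x, seminormPow nu p x ≤ A * ‖x‖ₑ ^ p)
    (hC : ∀ I : Finset (Fin m), IsLpSmooth nu p σ C (Measure.pi fun _ : I => pairMeasure μ)) :
    ∫⁻ x, seminormPow nu p (UStat h Function.eval N x) ^ σ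
        ∂Measure.infinitePi (fun _ : ℕ => μ) ≤
      (rosenthalConst σ C ^ m * A ^ σ : ℝ≥0) *
        ∑ J, mixedMoment μ σ (Inc m N) (fun i x => ‖h i x‖ₑ ^ p) J := by
  obtain ⟨t₀⟩ := nonempty_of_isProbabilityMeasure μ
  have moment_le := (isCenteredKernel_pairKernel hh N).lintegral_rpow_partialLpPow_le (N := N)
    hnu hp hσ hC Finset.univ ∅ (Finset.disjoint_empty_right _) fun _ => (0, t₀)
  simp only [partialLpPow, lmarginal_empty, partialSum_pairKernel_univ, Finset.union_empty,
    Finset.card_univ, Fintype.card_fin, Finset.powerset_univ,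
    ← Finset.compl_eq_univ_sdiff] at moment_le
  refine moment_le.trans ?_
  rw [ENNReal.coe_mul, mul_assoc, ENNReal.coe_pow, Finset.mul_sum _ _ ((A ^ σ : ℝ≥0) : ℝ≥0∞)]
  gcongr with J
  exact mixedIntegral_pairKernel_le (fun i hi => (hh i hi).measurable) (zero_lt_one.trans_le hp)
    (zero_le_one.trans hσ) hA J _

end CoordinateVariables

theorem exists_maxMoment_eval_le {B : Type w} [NormedAddCommGroup B] [NormedSpace ℝ B]
    [CompleteSpace B] [MeasurableSpace B] [BorelSpace B] [SecondCountableTopology B]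
    {r p q : ℝ} (hB : IsRSmooth B r) (hr2 : r ≤ 2) (hp1 : 1 < p) (hpr : p ≤ r) (hpq : p ≤ q)
    (m : ℕ) :
    ∃ K : ℝ≥0, ∀ (S : Type v) [MeasurableSpace S] (μ : Measure S) [IsProbabilityMeasure μ]
      (h : (Fin m → ℕ) → (Fin m → S) → B)
      (_ : ∀ i, StrictMono i → IsPointwiseDegenerate μ (h i)) (N : ℕ),
      maxMoment h Function.eval (Measure.infinitePi fun _ : ℕ => μ) N q ≤
        K * ∑ J, mixedMoment μ (q / p) (Inc m N) (fun i x => ‖h i x‖ₑ ^ p) J := by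
  obtain ⟨nu, hnu, ⟨C, two_point⟩, A, hA⟩ := hB.exists_seminorm hp1.le hpr hr2
  have hσ : 1 ≤ q / p := (one_le_div (zero_lt_one.trans hp1)).2 hpq
  obtain ⟨C', smooth⟩ := two_point.exists_isLpSmooth.{v} hnu hp1.le (hpr.trans hr2) hσ
  refine ⟨A ^ (q / p) * doobConst q * (rosenthalConst (q / p) C' ^ m * A ^ (q / p)),
    fun S _ μ _ h hh N => ?_⟩
  refine (maxMoment_eval_le hh hnu (zero_lt_one.trans hp1) (hp1.trans_le hpq)
    (fun x => (hA x).2) N).trans ?_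
  rw [ENNReal.coe_mul (A ^ (q / p) * doobConst q), mul_assoc]
  gcongr
  exact lintegral_seminormPow_UStat_rpow_le hh hnu hp1.le hσ (fun x => (hA x).1)
    fun I => smooth _ _

section PointwiseDegenerate

variable {ι : Type*} [DecidableEq ι]

section Sections

variable {S : ι → Type*} [∀ i, MeasurableSpace (S i)]

/-- The points of `A` for which almost every change of a single coordinate stays in `A`. -/
def sectionCore (μ : ∀ i, Measure (S i)) (A : Set (∀ i, S i)) : Set (∀ i, S i) :=
  A ∩ ⋂ l, {x | ∀ᵐ t ∂μ l, Function.update x l t ∈ A}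

variable [Countable ι] (μ : ∀ i, Measure (S i)) [∀ i, IsProbabilityMeasure (μ i)]
  {A : Set (∀ i, S i)}

theorem measurableSet_sectionCore (hA : MeasurableSet A) : MeasurableSet (sectionCore μ A) :=
  hA.inter <| MeasurableSet.iInter fun l =>
    measurable_measure_prodMk_left (measurable_update_prodMk l hA.compl) (measurableSet_singleton 0)

theorem ae_mem_sectionCore (hA : ∀ᵐ x ∂Measure.infinitePi μ, x ∈ A) :
    ∀ᵐ x ∂Measure.infinitePi μ, x ∈ sectionCore μ A := by
  have sections (l : ι) : ∀ᵐ x ∂Measure.infinitePi μ, ∀ᵐ t ∂μ l, Function.update x l t ∈ A :=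
    Measure.ae_ae_of_ae_prod
      ((measurePreserving_update_infinitePi μ l).quasiMeasurePreserving.ae hA)
  filter_upwards [hA, ae_all_iff.2 sections] with x hx hx' using ⟨hx, Set.mem_iInter.2 hx'⟩

-- `G` is the intersection of the iterates of `sectionCore` on a measurable subset of `A`.
theorem exists_subset_forall_ae_update_mem (hA : ∀ᵐ x ∂Measure.infinitePi μ, x ∈ A) :
    ∃ G ⊆ A, MeasurableSet G ∧ (∀ᵐ x ∂Measure.infinitePi μ, x ∈ G) ∧
      ∀ x ∈ G, ∀ l, ∀ᵐ t ∂μ l, Function.update x l t ∈ G := by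
  obtain ⟨E, hAE, hE, hE0⟩ := exists_measurable_superset_of_null (ae_iff.1 hA)
  let core (n : ℕ) : Set (∀ i, S i) := (sectionCore μ)^[n] Eᶜ
  have core_succ (n : ℕ) : core (n + 1) = sectionCore μ (core n) :=
    Function.iterate_succ_apply' _ _ _
  have measurable_core (n : ℕ) : MeasurableSet (core n) := by
    induction n with
    | zero => exact hE.compl
    | succ n ih => exact core_succ n ▸ measurableSet_sectionCore μ ih
  have ae_mem_core (n : ℕ) : ∀ᵐ x ∂Measure.infinitePi μ, x ∈ core n := by
    induction n with
    | zero => exact measure_eq_zero_iff_ae_notMem.1 hE0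
    | succ n ih => exact core_succ n ▸ ae_mem_sectionCore μ ih
  refine ⟨⋂ n, core n, fun x hx => ?_, .iInter measurable_core, ?_, fun x hx l => ?_⟩
  · by_contra hxA
    exact Set.mem_iInter.1 hx 0 (hAE hxA)
  · simpa only [Set.mem_iInter] using ae_all_iff.2 ae_mem_core
  · simp only [Set.mem_iInter] at hx ⊢
    exact ae_all_iff.2 fun n => Set.mem_iInter.1 (core_succ n ▸ hx (n + 1)).2 l

end Sections

variable [Countable ι] {S B : Type*} [MeasurableSpace S] {μ : Measure S} [IsProbabilityMeasure μ]
  [NormedAddCommGroup B] [NormedSpace ℝ B] [MeasurableSpace B]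

theorem exists_isPointwiseDegenerate_ae_eq {f : (ι → S) → B} (hf : Measurable f)
    (hf0 : ∀ l, ∀ᵐ x ∂Measure.infinitePi fun _ : ι => μ,
      Integrable (fun t => f (Function.update x l t)) μ ∧
        ∫ t, f (Function.update x l t) ∂μ = 0) :
    ∃ g, IsPointwiseDegenerate μ g ∧ g =ᵐ[Measure.infinitePi fun _ : ι => μ] f := by
  obtain ⟨G, hG, G_meas, ae_mem_G, update_mem_G⟩ :=
    exists_subset_forall_ae_update_mem (fun _ : ι => μ) (ae_all_iff.2 hf0)
  -- a section of the indicator is either zero or agrees a.e. with the section of `f` at a point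
  -- of `G`
  have centered (x : ι → S) (l : ι) :
      Integrable (fun t => G.indicator f (Function.update x l t)) μ ∧
        ∫ t, G.indicator f (Function.update x l t) ∂μ = 0 := by
    by_cases hx : ∃ s, Function.update x l s ∈ G
    · obtain ⟨s, hs⟩ := hx
      have mem_G := update_mem_G _ hs l
      obtain ⟨f_int, f_zero⟩ := hG hs l
      simp only [Function.update_idem] at mem_G f_int f_zero
      have agree : (fun t => f (Function.update x l t)) =ᵐ[μ]
          fun t => G.indicator f (Function.update x l t) := by
        filter_upwards [mem_G] with t ht using (Set.indicator_of_mem ht f).symm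
      exact ⟨f_int.congr agree, (integral_congr_ae agree).symm.trans f_zero⟩
    · push Not at hx
      simp [Set.indicator_of_notMem (hx _)]
  refine ⟨G.indicator f, ⟨hf.indicator G_meas, fun x l => (centered x l).1,
    fun x l => (centered x l).2⟩, ?_⟩
  filter_upwards [ae_mem_G] with x hx using Set.indicator_of_mem hx f

end PointwiseDegenerate

section UpdateIntegrals

variable {ι : Type*} [DecidableEq ι] {S : ι → Type*} [∀ i, MeasurableSpace (S i)]
  {μ : ∀ i, Measure (S i)} [∀ i, IsProbabilityMeasure (μ i)]
  {B : Type*} [NormedAddCommGroup B] {f : (∀ i, S i) → B}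

theorem integrable_update_prod (hf : Integrable f (Measure.infinitePi μ)) (l : ι) :
    Integrable (fun z : (∀ i, S i) × S l => f (Function.update z.1 l z.2))
      ((Measure.infinitePi μ).prod (μ l)) :=
  (measurePreserving_update_infinitePi μ l).integrable_comp_of_integrable hf

variable [NormedSpace ℝ B]

theorem integral_infinitePi_update (hf : Integrable f (Measure.infinitePi μ)) (l : ι) :
    ∫ x, f x ∂Measure.infinitePi μ =
      ∫ x, ∫ t, f (Function.update x l t) ∂μ l ∂Measure.infinitePi μ := by
  have hmp := measurePreserving_update_infinitePi μ l
  rw [← integral_prod _ (integrable_update_prod hf l),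
    ← integral_map hmp.measurable.aemeasurable (by simpa only [hmp.map_eq] using hf.1), hmp.map_eq]

theorem setIntegral_integral_update (hf : Integrable f (Measure.infinitePi μ)) {l : ι}
    {E : Set (∀ i, S i)} (hE : MeasurableSet E) (hEl : DependsOn (· ∈ E) ({l}ᶜ : Set ι)) :
    ∫ x in E, ∫ t, f (Function.update x l t) ∂μ l ∂Measure.infinitePi μ =
      ∫ x in E, f x ∂Measure.infinitePi μ := by
  rw [← integral_indicator hE, ← integral_indicator hE,
    integral_infinitePi_update (hf.indicator hE) l]
  refine integral_congr_ae (.of_forall fun x => ?_)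
  have mem_iff (t : S l) : Function.update x l t ∈ E ↔ x ∈ E :=
    iff_of_eq (update_eq_of_dependsOn hEl (by simp) x t)
  by_cases hx : x ∈ E <;> simp [Set.indicator, mem_iff, hx]

omit [∀ i, MeasurableSpace (S i)] in
theorem dependsOn_integral_update (l : ι) [MeasurableSpace (S l)] (ν : Measure (S l)) :
    DependsOn (fun x => ∫ t, f (Function.update x l t) ∂ν) ({l}ᶜ : Set ι) := fun x y hxy => by
  have update_eq : Function.update x l = Function.update y l := by
    ext t j
    rcases eq_or_ne j l with rfl | hj
    · simp
    · simpa [hj] using hxy j hj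
  simp only [update_eq]

end UpdateIntegrals

section IIDSequences

variable {Ω : Type u} {S : Type v} [MeasurableSpace S] {ξ : ℕ → Ω → S} {m : ℕ}
  {J : Finset (Fin m)}

theorem measurable_firstVars_sigmaOf [Nonempty S] {E : Type*} [MeasurableSpace E]
    {f : (Fin m → S) → E} (hf : Measurable f) (hdep : DependsOn f (J : Set (Fin m))) :
    Measurable[sigmaOf ξ J] fun ω => f (firstVars ξ m ω) := by
  obtain ⟨s⟩ := ‹Nonempty S›
  have factor : (fun ω => f (firstVars ξ m ω)) =
      (fun y : J → S => f (Function.updateFinset (fun _ => s) J y)) ∘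
        fun ω (j : J) => ξ (j : Fin m) ω := by
    ext ω
    exact hdep fun j hj => by simp_all [Function.updateFinset, firstVars]
  rw [factor]
  exact (hf.comp measurable_updateFinset).comp (comap_measurable _)

theorem exists_eq_preimage_firstVars {s : Set Ω} (hs : MeasurableSet[sigmaOf ξ J] s) :
    ∃ E : Set (Fin m → S), MeasurableSet E ∧ DependsOn (· ∈ E) (J : Set (Fin m)) ∧
      s = firstVars ξ m ⁻¹' E := by
  obtain ⟨E, hE, rfl⟩ := hs
  exact ⟨J.restrict ⁻¹' E, J.measurable_restrict hE,
    fun _ _ hxy => congrArg (· ∈ E) (J.dependsOn_restrict hxy), rfl⟩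

variable [MeasurableSpace Ω] {P : Measure Ω}

namespace IsIIDSeq

theorem measurable_firstVars (hξ : IsIIDSeq ξ P) : Measurable (firstVars ξ m) :=
  measurable_pi_lambda _ fun l => hξ.measurable l

theorem sigmaOf_le (hξ : IsIIDSeq ξ P) (J : Finset (Fin m)) :
    sigmaOf ξ J ≤ ‹MeasurableSpace Ω› :=
  (measurable_pi_lambda _ fun j : J => hξ.measurable (j : Fin m)).comap_le

theorem map_comp {ι : Type*} (hξ : IsIIDSeq ξ P) {i : ι → ℕ} (hi : Function.Injective i) :
    P.map (fun ω l => ξ (i l) ω) = Measure.infinitePi fun _ : ι => P.map (ξ 0) := by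
  rw [iIndepFun.map_fun_eq_infinitePi_map (fun l => hξ.measurable (i l)) (hξ.indep.precomp hi)]
  exact congrArg Measure.infinitePi (funext fun l => (hξ.identDistrib (i l)).map_eq)

theorem map_firstVars (hξ : IsIIDSeq ξ P) :
    P.map (firstVars ξ m) = Measure.infinitePi fun _ : Fin m => P.map (ξ 0) :=
  hξ.map_comp Fin.val_injective

variable [IsProbabilityMeasure P]

theorem isProbabilityMeasure (hξ : IsIIDSeq ξ P) : IsProbabilityMeasure (P.map (ξ 0)) :=
  Measure.isProbabilityMeasure_map (hξ.measurable 0).aemeasurable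

theorem lintegral_firstVars (hξ : IsIIDSeq ξ P) {f : (Fin m → S) → ℝ≥0∞} (hf : Measurable f) :
    ∫⁻ ω, f (firstVars ξ m ω) ∂P = ∫⁻ x, f x ∂Measure.pi fun _ => P.map (ξ 0) := by
  have := hξ.isProbabilityMeasure
  rw [← Measure.infinitePi_eq_pi, ← hξ.map_firstVars, lintegral_map hf hξ.measurable_firstVars]

theorem condLExp_ae_eq_lmarginal (hξ : IsIIDSeq ξ P) (J : Finset (Fin m))
    {f : (Fin m → S) → ℝ≥0∞} (hf : Measurable f) :
    condLExp (sigmaOf ξ J) P (fun ω => f (firstVars ξ m ω)) =ᵐ[P]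
      fun ω => (∫⋯∫⁻_Jᶜ, f ∂fun _ => P.map (ξ 0)) (firstVars ξ m ω) := by
  have := hξ.isProbabilityMeasure
  have : Nonempty S := (nonempty_of_isProbabilityMeasure P).map (ξ 0)
  have hmF := hξ.measurable_firstVars (m := m)
  refine (ae_eq_condLExp (hm := hξ.sigmaOf_le J) P _ ?_ fun s hs => ?_).symm
  · exact measurable_firstVars_sigmaOf (hf.lmarginal _)
      (by simpa using dependsOn_lmarginal (s := Jᶜ) (μ := fun _ => P.map (ξ 0)) f)
  · obtain ⟨E, hE, hEJ, rfl⟩ := exists_eq_preimage_firstVars hs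
    rw [← lintegral_indicator (hmF hE), ← lintegral_indicator (hmF hE)]
    calc ∫⁻ ω, (E.indicator (∫⋯∫⁻_Jᶜ, f ∂fun _ => P.map (ξ 0))) (firstVars ξ m ω) ∂P
        = ∫⁻ x, (∫⋯∫⁻_Jᶜ, E.indicator f ∂fun _ => P.map (ξ 0)) x
            ∂Measure.pi fun _ => P.map (ξ 0) := by
          rw [hξ.lintegral_firstVars ((hf.lmarginal _).indicator hE),
            lmarginal_indicator (by simpa using hEJ)]
      _ = ∫⁻ ω, E.indicator f (firstVars ξ m ω) ∂P := by
          rw [lintegral_lmarginal (hf.indicator hE), hξ.lintegral_firstVars (hf.indicator hE)]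

variable {B : Type w} [NormedAddCommGroup B] [NormedSpace ℝ B] [CompleteSpace B]
  [MeasurableSpace B] [BorelSpace B] [SecondCountableTopology B] {f : (Fin m → S) → B}

theorem condExp_compl_singleton_ae_eq (hξ : IsIIDSeq ξ P) (hf : Measurable f)
    (hfi : Integrable (fun ω => f (firstVars ξ m ω)) P) (l : Fin m) :
    P[fun ω => f (firstVars ξ m ω) | sigmaOf ξ ({l}ᶜ : Finset (Fin m))] =ᵐ[P]
      fun ω => ∫ t, f (Function.update (firstVars ξ m ω) l t) ∂P.map (ξ 0) := by
  have := hξ.isProbabilityMeasure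
  have : Nonempty S := (nonempty_of_isProbabilityMeasure P).map (ξ 0)
  have hmF := hξ.measurable_firstVars (m := m)
  have hfi' : Integrable f (Measure.infinitePi fun _ : Fin m => P.map (ξ 0)) := by
    rw [← hξ.map_firstVars]
    exact (integrable_map_measure hf.aestronglyMeasurable hmF.aemeasurable).2 hfi
  set c : (Fin m → S) → B := fun x => ∫ t, f (Function.update x l t) ∂P.map (ξ 0)
  have c_meas : StronglyMeasurable c :=
    (hf.comp (measurable_update_prodMk l)).stronglyMeasurable.integral_prod_right'
  have c_int : Integrable (fun ω => c (firstVars ξ m ω)) P := by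
    refine (integrable_map_measure c_meas.aestronglyMeasurable hmF.aemeasurable).1 ?_
    rw [hξ.map_firstVars]
    exact (integrable_update_prod hfi' l).integral_prod_left
  refine (ae_eq_condExp_of_forall_setIntegral_eq (hξ.sigmaOf_le _) hfi
    (fun s _ _ => c_int.integrableOn) (fun s hs _ => ?_) ?_).symm
  · obtain ⟨E, hE, hEl, rfl⟩ := exists_eq_preimage_firstVars hs
    rw [← setIntegral_map hE c_meas.aestronglyMeasurable hmF.aemeasurable,
      ← setIntegral_map hE hf.aestronglyMeasurable hmF.aemeasurable, hξ.map_firstVars]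
    exact setIntegral_integral_update hfi' hE (by simpa using hEl)
  · exact (measurable_firstVars_sigmaOf c_meas.measurable
      (by simpa using dependsOn_integral_update l _)).aestronglyMeasurable

end IsIIDSeq

variable [IsProbabilityMeasure P] {B : Type w} [NormedAddCommGroup B] [NormedSpace ℝ B]
  [CompleteSpace B] [MeasurableSpace B] [BorelSpace B] [SecondCountableTopology B]
  {f : (Fin m → S) → B}

theorem IsDegenerated.ae_integrable_and_integral_update_eq_zero (hd : IsDegenerated f ξ P)
    (hξ : IsIIDSeq ξ P) (hf : Measurable f) (l : Fin m) :
    ∀ᵐ x ∂Measure.infinitePi fun _ : Fin m => P.map (ξ 0),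
      Integrable (fun t => f (Function.update x l t)) (P.map (ξ 0)) ∧
        ∫ t, f (Function.update x l t) ∂P.map (ξ 0) = 0 := by
  have := hξ.isProbabilityMeasure
  have hmF := hξ.measurable_firstVars (m := m)
  have f_int : Integrable f (Measure.infinitePi fun _ : Fin m => P.map (ξ 0)) := by
    rw [← hξ.map_firstVars]
    exact (integrable_map_measure hf.aestronglyMeasurable hmF.aemeasurable).2 hd.integrable
  have c_meas : Measurable fun x => ∫ t, f (Function.update x l t) ∂P.map (ξ 0) :=
    (hf.comp (measurable_update_prodMk l)).stronglyMeasurable.integral_prod_right'.measurable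
  have c_zero : ∀ᵐ x ∂Measure.infinitePi fun _ : Fin m => P.map (ξ 0),
      ∫ t, f (Function.update x l t) ∂P.map (ξ 0) = 0 := by
    rw [← hξ.map_firstVars]
    exact (ae_map_iff hmF.aemeasurable (c_meas (measurableSet_singleton 0))).2
      ((hξ.condExp_compl_singleton_ae_eq hf hd.integrable l).symm.trans (hd.condExp_eq_zero l))
  filter_upwards [c_zero, (integrable_update_prod f_int l).prod_right_ae] with x hx0 hxi
    using ⟨hxi, hx0⟩

theorem IsDegenerated.exists_isPointwiseDegenerate (hd : IsDegenerated f ξ P) (hξ : IsIIDSeq ξ P)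
    (hf : Measurable f) :
    ∃ g, IsPointwiseDegenerate (P.map (ξ 0)) g ∧
      g =ᵐ[Measure.infinitePi fun _ : Fin m => P.map (ξ 0)] f :=
  have := hξ.isProbabilityMeasure
  exists_isPointwiseDegenerate_ae_eq hf
    (hd.ae_integrable_and_integral_update_eq_zero hξ hf)

end IIDSequences

section CondMixedMoments

variable {Ω : Type u} [MeasurableSpace Ω] {S : Type v} [MeasurableSpace S] {B : Type w}
  [NormedAddCommGroup B] {P : Measure Ω} {ξ : ℕ → Ω → S} {m N : ℕ}
  {h h' : (Fin m → ℕ) → (Fin m → S) → B} {p q σ : ℝ} {J : Finset (Fin m)}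

/-- The sum over all `a` of the `σ`-th moments of the conditional moment sums, the counterpart of
`mixedMoment` on the probability space carrying `ξ`. -/
noncomputable def condMixedMoment (h : (Fin m → ℕ) → (Fin m → S) → B) (ξ : ℕ → Ω → S)
    (P : Measure Ω) (N : ℕ) (p σ : ℝ) (J : Finset (Fin m)) : ℝ≥0∞ :=
  ∑' a : J → ℕ, ∫⁻ ω, condMomentSum h ξ P N p J a ω ^ σ ∂P

theorem condMixedMoment_congr (hξ : IsIIDSeq ξ P) (hae : ∀ i, StrictMono i →
      h' i =ᵐ[Measure.infinitePi fun _ : Fin m => P.map (ξ 0)] h i) :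
    condMixedMoment h' ξ P N p σ J = condMixedMoment h ξ P N p σ J := by
  have condLExp_eq (i : Fin m → ℕ) (hi : i ∈ Inc m N) :
      condLExp (sigmaOf ξ J) P (fun ω => ‖h' i (firstVars ξ m ω)‖ₑ ^ p) =ᵐ[P]
        condLExp (sigmaOf ξ J) P (fun ω => ‖h i (firstVars ξ m ω)‖ₑ ^ p) := by
    have hi_ae := hae i (mem_Inc.1 hi).2
    rw [← hξ.map_firstVars] at hi_ae
    refine condLExp_congr_ae ?_
    filter_upwards [ae_of_ae_map hξ.measurable_firstVars.aemeasurable hi_ae] with ω hω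
    rw [hω]
  refine tsum_congr fun a => lintegral_congr_ae ?_
  filter_upwards [(Finset.eventually_all _).2 condLExp_eq] with ω hω
  exact congrArg (· ^ σ) (Finset.sum_congr rfl fun i hi => hω i (Finset.mem_filter.1 hi).1)

theorem IsIIDSeq.UStat_ae_eq (hξ : IsIIDSeq ξ P) (hae : ∀ i, StrictMono i →
      h' i =ᵐ[Measure.infinitePi fun _ : Fin m => P.map (ξ 0)] h i) (n : ℕ) :
    UStat h' ξ n =ᵐ[P] UStat h ξ n := by
  have summand_eq (i : Fin m → ℕ) (hi : i ∈ Inc m n) :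
      ∀ᵐ ω ∂P, h' i (fun l => ξ (i l) ω) = h i fun l => ξ (i l) ω := by
    have hi_mono := (mem_Inc.1 hi).2
    have hi_ae := hae i hi_mono
    rw [← hξ.map_comp hi_mono.injective] at hi_ae
    exact ae_of_ae_map (measurable_pi_iff.2 fun l => hξ.measurable (i l)).aemeasurable hi_ae
  filter_upwards [(Finset.eventually_all _).2 summand_eq] with ω hω
  exact Finset.sum_congr rfl hω

theorem maxMoment_congr (hξ : IsIIDSeq ξ P) (hae : ∀ i, StrictMono i →
      h' i =ᵐ[Measure.infinitePi fun _ : Fin m => P.map (ξ 0)] h i) :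
    maxMoment h' ξ P N q = maxMoment h ξ P N q := by
  refine lintegral_congr_ae ?_
  filter_upwards [ae_all_iff.2 (hξ.UStat_ae_eq hae)] with ω hω
  simp only [hω]

variable [MeasurableSpace B] [BorelSpace B]

theorem IsIIDSeq.maxMoment_eq_eval [SecondCountableTopology B] (hξ : IsIIDSeq ξ P)
    (hh : ∀ i, StrictMono i → Measurable (h i)) :
    maxMoment h ξ P N q =
      maxMoment h Function.eval (Measure.infinitePi fun _ : ℕ => P.map (ξ 0)) N q := by
  have sup_meas : Measurable fun x : ℕ → S =>
      (Finset.Icc m N).sup fun n => ‖UStat h Function.eval n x‖ₑ ^ q := by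
    simp only [Finset.sup_eq_iSup]
    exact .iSup fun n => .iSup fun _ => (measurable_UStat hh n).enorm.pow_const q
  rw [← hξ.map_comp Function.injective_id]
  exact (lintegral_map sup_meas (measurable_pi_iff.2 hξ.measurable)).symm

variable [IsProbabilityMeasure P]

theorem IsIIDSeq.condMixedMoment_eq_mixedMoment (hξ : IsIIDSeq ξ P)
    (hh : ∀ i, StrictMono i → Measurable (h i)) :
    condMixedMoment h ξ P N p σ J =
      mixedMoment (P.map (ξ 0)) σ (Inc m N) (fun i x => ‖h i x‖ₑ ^ p) J := by
  have := hξ.isProbabilityMeasure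
  have φ_meas (i : Fin m → ℕ) (hi : i ∈ Inc m N) : Measurable fun x => ‖h i x‖ₑ ^ p :=
    (hh i (mem_Inc.1 hi).2).enorm.pow_const p
  refine tsum_congr fun a => ?_
  rw [← hξ.lintegral_firstVars ((Finset.measurable_sum _ fun i hi =>
    (φ_meas i (Finset.mem_filter.1 hi).1).lmarginal _).pow_const _)]
  refine lintegral_congr_ae ?_
  filter_upwards [(Finset.eventually_all _).2 fun i hi =>
    hξ.condLExp_ae_eq_lmarginal J (φ_meas i hi)] with ω hω
  refine congrArg (· ^ σ) (Finset.sum_congr (by congr!) fun i hi => ?_)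
  exact hω i (Finset.mem_filter.1 hi).1

theorem IsIIDSeq.sumMoments_eq (hξ : IsIIDSeq ξ P) (hh : ∀ i, StrictMono i → Measurable (h i)) :
    sumMoments h ξ P N q =
      ∑ i ∈ Inc m N, ∫⁻ x, ‖h i x‖ₑ ^ q ∂Measure.pi fun _ => P.map (ξ 0) :=
  Finset.sum_congr rfl fun i hi =>
    hξ.lintegral_firstVars ((hh i (mem_Inc.1 hi).2).enorm.pow_const q)

theorem condMixedMoment_univ (hξ : IsIIDSeq ξ P) (hh : ∀ i, StrictMono i → Measurable (h i))
    (hp : 0 < p) (hq : 0 < q) :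
    condMixedMoment h ξ P N p (q / p) Finset.univ = sumMoments h ξ P N q := by
  rw [hξ.condMixedMoment_eq_mixedMoment hh, mixedMoment_univ (div_pos hq hp), hξ.sumMoments_eq hh]
  simp only [← ENNReal.rpow_mul, mul_div_cancel₀ q hp.ne']

theorem condMixedMoment_empty (hξ : IsIIDSeq ξ P) (hh : ∀ i, StrictMono i → Measurable (h i)) :
    condMixedMoment h ξ P N p σ ∅ = sumMoments h ξ P N p ^ σ := by
  have := hξ.isProbabilityMeasure
  rw [hξ.condMixedMoment_eq_mixedMoment hh, mixedMoment_empty, hξ.sumMoments_eq hh]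

theorem condMixedMoment_one (hξ : IsIIDSeq ξ P) (hh : ∀ i, StrictMono i → Measurable (h i))
    (J : Finset (Fin m)) : condMixedMoment h ξ P N p 1 J = sumMoments h ξ P N p := by
  have := hξ.isProbabilityMeasure
  rw [hξ.condMixedMoment_eq_mixedMoment hh, hξ.sumMoments_eq hh,
    mixedMoment_one fun i hi => (hh i (mem_Inc.1 hi).2).enorm.pow_const p]

end CondMixedMoments

theorem exists_maxMoment_le {B : Type w} [NormedAddCommGroup B] [NormedSpace ℝ B]
    [CompleteSpace B] [MeasurableSpace B] [BorelSpace B] [SecondCountableTopology B]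
    {r p q : ℝ} (hB : IsRSmooth B r) (hr2 : r ≤ 2) (hp1 : 1 < p) (hpr : p ≤ r) (hpq : p ≤ q)
    (m : ℕ) :
    ∃ K : ℝ≥0, ∀ (Ω : Type u) [MeasurableSpace Ω] (P : Measure Ω) [IsProbabilityMeasure P]
      (S : Type v) [MeasurableSpace S] (ξ : ℕ → Ω → S) (_ : IsIIDSeq ξ P)
      (h : (Fin m → ℕ) → (Fin m → S) → B) (_ : ∀ i, StrictMono i → Measurable (h i))
      (_ : ∀ i, StrictMono i → IsDegenerated (h i) ξ P) (N : ℕ),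
      maxMoment h ξ P N q ≤ K * ∑ J, condMixedMoment h ξ P N p (q / p) J := by
  obtain ⟨K, hK⟩ := exists_maxMoment_eval_le.{v, w} hB hr2 hp1 hpr hpq m
  refine ⟨K, fun Ω _ P _ S _ ξ hξ h hh hd N => ?_⟩
  have := hξ.isProbabilityMeasure
  choose! h' hdeg hae using fun i (hi : StrictMono i) =>
    (hd i hi).exists_isPointwiseDegenerate hξ (hh i hi)
  have hh' (i : Fin m → ℕ) (hi : StrictMono i) : Measurable (h' i) := (hdeg i hi).measurable
  calc maxMoment h ξ P N q
      = maxMoment h' Function.eval (Measure.infinitePi fun _ : ℕ => P.map (ξ 0)) N q := by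
        rw [← maxMoment_congr hξ hae, hξ.maxMoment_eq_eval hh']
    _ ≤ K * ∑ J, mixedMoment (P.map (ξ 0)) (q / p) (Inc m N) (fun i x => ‖h' i x‖ₑ ^ p) J :=
        hK S (P.map (ξ 0)) h' hdeg N
    _ = K * ∑ J, condMixedMoment h ξ P N p (q / p) J := by
        simp only [← hξ.condMixedMoment_eq_mixedMoment hh', condMixedMoment_congr hξ hae]

theorem sum_finset_le_sum_proper {ι : Type*} [Fintype ι] [DecidableEq ι]
    (f : Finset ι → ℝ≥0∞) :
    ∑ J, f J ≤ f Finset.univ + ∑ J : Finset ι with J.Nonempty ∧ J ≠ Finset.univ, f J + f ∅ := by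
  have split (J : Finset ι) : f J ≤ (if J = Finset.univ then f J else 0) +
      (if J.Nonempty ∧ J ≠ Finset.univ then f J else 0) + if J = ∅ then f J else 0 := by
    rcases eq_or_ne J Finset.univ with rfl | hJ
    · simp
    rcases J.eq_empty_or_nonempty with rfl | hJ0
    · simp
    · simp [hJ, hJ0]
  refine (Finset.sum_le_sum fun J _ => split J).trans_eq ?_
  simp [Finset.sum_add_distrib, Finset.sum_filter]

theorem mainTheorem4
    (B : Type w) [NormedAddCommGroup B] [NormedSpace ℝ B] [CompleteSpace B]
    [TopologicalSpace.SeparableSpace B] [MeasurableSpace B] [BorelSpace B]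
    (r : ℝ) (hr1 : 1 < r) (hr2 : r ≤ 2) (hB : IsRSmooth B r)
    (m : ℕ) (hm : 1 ≤ m) (p : ℝ) (hp1 : 1 < p) (hpr : p ≤ r) :
    (∀ q : ℝ, p ≤ q → ∃ K : ℝ≥0,
      ∀ (Ω : Type u) [MeasurableSpace Ω] (P : Measure Ω) [IsProbabilityMeasure P]
        (S : Type v) [MeasurableSpace S] (ξ : ℕ → Ω → S) (_ : IsIIDSeq ξ P)
        (h : (Fin m → ℕ) → (Fin m → S) → B)
        (_ : ∀ i, StrictMono i → Measurable (h i))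
        (_ : ∀ i, StrictMono i → IsDegenerated (h i) ξ P)
        (N : ℕ) (_ : m ≤ N),
        maxMoment h ξ P N q ≤
          K * sumMoments h ξ P N q
          + K * ∑ J : Finset (Fin m) with J.Nonempty ∧ J ≠ Finset.univ,
              ∑' a : J → ℕ, ∫⁻ ω, condMomentSum h ξ P N p J a ω ^ (q / p) ∂P
          + K * sumMoments h ξ P N p ^ (q / p)) ∧
    (∃ K : ℝ≥0,
      ∀ (Ω : Type u) [MeasurableSpace Ω] (P : Measure Ω) [IsProbabilityMeasure P]
        (S : Type v) [MeasurableSpace S] (ξ : ℕ → Ω → S) (_ : IsIIDSeq ξ P)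
        (h : (Fin m → ℕ) → (Fin m → S) → B)
        (_ : ∀ i, StrictMono i → Measurable (h i))
        (_ : ∀ i, StrictMono i → IsDegenerated (h i) ξ P)
        (N : ℕ) (_ : m ≤ N),
        maxMoment h ξ P N p ≤ K * sumMoments h ξ P N p) := by
  have : SecondCountableTopology B := UniformSpace.secondCountable_of_separable B
  have hp0 : 0 < p := zero_lt_one.trans hp1
  refine ⟨fun q hpq => ?_, ?_⟩
  · obtain ⟨K, hK⟩ := exists_maxMoment_le.{u, v, w} hB hr2 hp1 hpr hpq m
    refine ⟨K, fun Ω _ P _ S _ ξ hξ h hh hd N _ => (hK Ω P S ξ hξ h hh hd N).trans ?_⟩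
    rw [← condMixedMoment_univ hξ hh hp0 (hp0.trans_le hpq), ← condMixedMoment_empty hξ hh,
      ← mul_add, ← mul_add]
    gcongr
    exact sum_finset_le_sum_proper (condMixedMoment h ξ P N p (q / p))
  · obtain ⟨K, hK⟩ := exists_maxMoment_le.{u, v, w} hB hr2 hp1 hpr le_rfl m
    refine ⟨K * Fintype.card (Finset (Fin m)), fun Ω _ P _ S _ ξ hξ h hh hd N _ =>
      (hK Ω P S ξ hξ h hh hd N).trans_eq ?_⟩
    simp only [div_self hp0.ne', condMixedMoment_one hξ hh, Finset.sum_const, nsmul_eq_mul,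
      Finset.card_univ, ENNReal.coe_mul, ENNReal.coe_natCast, mul_assoc]
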